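/- Let $n\ge 2$ be an integer. Let $A_n=\mathbb{C}[x_1^{\pm1},\dots,x_n^{\pm1}]$, $\partial_i=x_i\frac{\partial}{\partial x_i}$, and let $\mathcal{K}_n=A_n[\partial_1,\dots,\partial_n]$ be the Weyl algebra over $A_n$, that is, the associative algebra of linear operators on $A_n$ generated by the multiplications by elements of $A_n$ and by $\partial_1,\dots,\partial_n$. For $u\in\mathbb{C}^n$ and $r\in\mathbb{Z}^n$ put $(u|r)=\sum_i u_ir_i$, $x^r=x_1^{r_1}\cdots x_n^{r_n}$ and $D(u,r)=x^r\sum_{i=1}^n u_i\partial_i$. Let $$\mathbb{S}_n=\mathrm{span}_{\mathbb{C}}\{D(u,r)\mid u\in\mathbb{C}^n,\ r\in\mathbb{Z}^n,\ (u|r)=0\}$$ be the Lie algebra of divergence zero vector fields on the $n$-dimensional torus, a Lie subalgebra of the Lie algebra of derivations of $A_n$. For a $\mathcal{K}_n$-module $P$ and an $\mathfrak{sl}_n(\mathbb{C})$-module $V$, let $\mathcal{F}(P,V)=P\otimes_{\mathbb{C}}V$ be the $\mathbb{S}_n$-module with the action $$D(u,r)(z\otimes y)=D(u,r)z\otimes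 y+x^rz\otimes (ru^T)y,\qquad z\in P,\ y\in V,\ (u|r)=0 .$$ **Theorem.** Let $P$ be an irreducible $\mathcal{K}_n$-module and let $V$ be an irreducible $\mathfrak{sl}_n(\mathbb{C})$-module (not necessarily a weight module, possibly infinite-dimensional) that is not isomorphic to the exterior power $V(\delta_k)=\bigwedge^k(\mathbb{C}^n)$ of the natural module for any $k=0,1,\dots,n-1$ (where $\bigwedge^0(\mathbb{C}^n)=\mathbb{C}$ is the trivial module). Then the $\mathbb{S}_n$-module $\mathcal{F}(P,V)$ is irreducible. -/

import Mathlib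

namespace TorusFields

noncomputable section

open scoped TensorProduct

attribute [local instance 100] LieRing.ofAssociativeRing

/-! ### The Laurent polynomial algebra, its Weyl algebra and its vector fields -/

/-- The Laurent polynomial algebra `A_n = ℂ[x₁^{±1}, …, x_n^{±1}]`. -/
def Laurent (n : ℕ) : Type := AddMonoidAlgebra ℂ (Fin n → ℤ)

instance (n : ℕ) : CommRing (Laurent n) :=
  inferInstanceAs (CommRing (AddMonoidAlgebra ℂ (Fin n → ℤ)))

instance (n : ℕ) : Algebra ℂ (Laurent n) :=
  inferInstanceAs (Algebra ℂ (AddMonoidAlgebra ℂ (Fin n → ℤ)))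

/-- The basis of `A_n` given by the monomials. -/
def monBasis (n : ℕ) : Module.Basis (Fin n → ℤ) ℂ (Laurent n) :=
  AddMonoidAlgebra.basis (Fin n → ℤ) ℂ

/-- The monomial `x^r`. -/
def mon {n : ℕ} (r : Fin n → ℤ) : Laurent n := AddMonoidAlgebra.single r 1

lemma monBasis_apply {n : ℕ} (r : Fin n → ℤ) : monBasis n r = mon r := rfl

lemma mon_mul {n : ℕ} (r s : Fin n → ℤ) : mon r * mon s = mon (r + s) :=
  (AddMonoidAlgebra.single_mul_single r s (1 : ℂ) 1).trans (by rw [one_mul]; rfl)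

lemma mon_zero {n : ℕ} : mon (0 : Fin n → ℤ) = 1 := rfl

/-- The underlying linear map of `∂_i = x_i ∂/∂x_i`, with `∂_i (x^s) = s_i x^s`. -/
def eulerLin {n : ℕ} (i : Fin n) : Laurent n →ₗ[ℂ] Laurent n :=
  (monBasis n).constr ℂ fun s => (s i : ℂ) • mon s

lemma eulerLin_mon {n : ℕ} (i : Fin n) (s : Fin n → ℤ) :
    eulerLin i (mon s) = (s i : ℂ) • mon s := by
  rw [← monBasis_apply, eulerLin, Module.Basis.constr_basis, monBasis_apply]

lemma laurent_ext {n : ℕ} {M : Type*} [AddCommGroup M] [Module ℂ M]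
    {f g : Laurent n →ₗ[ℂ] M} (h : ∀ s, f (mon s) = g (mon s)) : f = g :=
  (monBasis n).ext fun s => by rw [monBasis_apply, h]

lemma eulerLin_leibniz {n : ℕ} (i : Fin n) (a b : Laurent n) :
    eulerLin i (a * b) = a • eulerLin i b + b • eulerLin i a := by
  have key : (LinearMap.mul ℂ (Laurent n)).compr₂ (eulerLin i) =
      (LinearMap.mul ℂ (Laurent n)).compl₂ (eulerLin i) +
        ((LinearMap.mul ℂ (Laurent n)).compl₂ (eulerLin i)).flip := by
    refine laurent_ext fun r => laurent_ext fun s => ?_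
    simp only [LinearMap.compr₂_apply, LinearMap.mul_apply', LinearMap.add_apply,
      LinearMap.compl₂_apply, LinearMap.flip_apply, mon_mul, eulerLin_mon, mul_smul_comm]
    rw [add_comm s r, ← add_smul]
    congr 1
    simp [add_comm]
  simpa using LinearMap.congr_fun₂ key a b

/-- The Lie algebra `W_n` of derivations of `A_n` (vector fields on the torus). -/
abbrev Witt (n : ℕ) : Type := Derivation ℂ (Laurent n) (Laurent n)

/-- The derivation `∂_i = x_i ∂/∂x_i` of `A_n`. -/
def euler {n : ℕ} (i : Fin n) : Witt n := Derivation.mk' (eulerLin i) (eulerLin_leibniz i)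

lemma euler_mon {n : ℕ} (i : Fin n) (s : Fin n → ℤ) :
    euler i (mon s) = (s i : ℂ) • mon s := eulerLin_mon i s

/-- The Weyl algebra `K_n = A_n[∂₁, …, ∂_n]` over `A_n`: the algebra of differential operators on
`A_n`, i.e. the algebra of endomorphisms of the vector space `A_n` generated by the
multiplications by elements of `A_n` and the `∂_i`. -/
def Weyl (n : ℕ) : Subalgebra ℂ (Module.End ℂ (Laurent n)) :=
  Algebra.adjoin ℂ
    (Set.range (fun f : Laurent n => LinearMap.mulLeft ℂ f) ∪
      Set.range (fun i : Fin n => (euler i : Laurent n →ₗ[ℂ] Laurent n)))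

/-- An element of `A_n`, seen in the Weyl algebra. -/
def Weyl.ofLaurent {n : ℕ} : Laurent n →ₗ[ℂ] Weyl n :=
  LinearMap.codRestrict (Subalgebra.toSubmodule (Weyl n)) (LinearMap.mul ℂ (Laurent n))
    fun f => Algebra.subset_adjoin (Or.inl ⟨f, rfl⟩)

/-- The standard symmetric bilinear form `(u | r) = uᵀ r`, for `u ∈ ℂⁿ` and `r ∈ ℤⁿ`. -/
def pair {n : ℕ} (u : Fin n → ℂ) (r : Fin n → ℤ) : ℂ := ∑ i, u i * (r i : ℂ)

/-- The vector field `D(u, r) = x^r ∑ᵢ uᵢ ∂ᵢ`. -/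
def D {n : ℕ} (u : Fin n → ℂ) (r : Fin n → ℤ) : Witt n := mon r • ∑ i, u i • euler i

lemma D_mon {n : ℕ} (u : Fin n → ℂ) (r s : Fin n → ℤ) :
    D u r (mon s) = pair u s • mon (r + s) := by
  have h : (∑ i, u i • euler i : Witt n) (mon s) = pair u s • mon s := by
    have h' : (∑ i, u i • euler i : Witt n) (mon s) = ∑ i, u i • euler i (mon s) :=
      map_sum ({ toFun := fun d : Witt n => d (mon s), map_zero' := rfl,
                 map_add' := fun _ _ => rfl } : Witt n →+ Laurent n)
        (fun i => u i • euler i) Finset.univ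
    rw [h']
    simp only [pair, Finset.sum_smul, mul_smul, euler_mon]
  rw [D, Derivation.smul_apply, h, smul_eq_mul, mul_smul_comm, mon_mul]

lemma witt_ext {n : ℕ} {d e : Witt n} (h : ∀ s, d (mon s) = e (mon s)) : d = e :=
  Derivation.ext fun a =>
    LinearMap.congr_fun (laurent_ext (f := (d : Laurent n →ₗ[ℂ] Laurent n)) (g := e) h) a

lemma pair_add {n : ℕ} (u : Fin n → ℂ) (r s : Fin n → ℤ) :
    pair u (r + s) = pair u r + pair u s := by
  simp [pair, mul_add, Finset.sum_add_distrib]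

lemma pair_smul_sub_smul {n : ℕ} (a b : ℂ) (u v : Fin n → ℂ) (r : Fin n → ℤ) :
    pair (a • v - b • u) r = a * pair v r - b * pair u r := by
  simp [pair, sub_mul, mul_assoc, Finset.sum_sub_distrib, Finset.mul_sum]

/-- `[D(u,r), D(v,s)] = D(w, r+s)` with `w = (u|s) v - (v|r) u`. -/
lemma lie_D {n : ℕ} (u v : Fin n → ℂ) (r s : Fin n → ℤ) :
    ⁅D u r, D v s⁆ = D (pair u s • v - pair v r • u) (r + s) := by
  refine witt_ext fun t => ?_
  rw [Derivation.commutator_apply, D_mon, D_mon, D_mon, Derivation.map_smul, Derivation.map_smul, D_mon, D_mon,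
    smul_smul, smul_smul, pair_add, pair_add, pair_smul_sub_smul, add_left_comm s r t,
    ← add_assoc r s t, ← sub_smul]
  congr 1
  ring

/-- The span of the `D(u, r)` with `(u | r) = 0`. -/
def divZeroSpan (n : ℕ) : Submodule ℂ (Witt n) :=
  Submodule.span ℂ {d : Witt n | ∃ u r, pair u r = 0 ∧ d = D u r}

lemma lie_mem_divZeroSpan {n : ℕ} {x y : Witt n} (hx : x ∈ divZeroSpan n)
    (hy : y ∈ divZeroSpan n) : ⁅x, y⁆ ∈ divZeroSpan n := by
  have hB : ∀ a b : Witt n, ⁅a, b⁆ = LieModule.toEnd ℂ (Witt n) (Witt n) a b := fun _ _ => rfl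
  refine Submodule.span_induction₂ (p := fun x y _ _ => ⁅x, y⁆ ∈ divZeroSpan n)
    ?_ ?_ ?_ ?_ ?_ ?_ ?_ hx hy
  · rintro _ _ ⟨u, r, hu, rfl⟩ ⟨v, s, hv, rfl⟩
    rw [lie_D]
    refine Submodule.subset_span ⟨_, _, ?_, rfl⟩
    rw [pair_smul_sub_smul, pair_add, pair_add, hu, hv]
    ring
  · intro y _; rw [hB, map_zero]; exact Submodule.zero_mem _
  · intro x _; rw [hB, map_zero]; exact Submodule.zero_mem _
  · intro x y z _ _ _ h₁ h₂; rw [hB, map_add]; exact Submodule.add_mem _ h₁ h₂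
  · intro x y z _ _ _ h₁ h₂; rw [hB, map_add]; exact Submodule.add_mem _ h₁ h₂
  · intro c x y _ _ h; rw [hB, map_smul]; exact Submodule.smul_mem _ _ h
  · intro c x y _ _ h; rw [hB, map_smul]; exact Submodule.smul_mem _ _ h

/-- The Lie algebra `𝕊_n` of divergence zero vector fields on the `n`-dimensional torus: the span
of the `D(u, r)` with `(u | r) = 0`, a Lie subalgebra of `W_n`. -/
def DivZero (n : ℕ) : LieSubalgebra ℂ (Witt n) where
  __ := divZeroSpan n
  lie_mem' := lie_mem_divZeroSpan

lemma D_mem {n : ℕ} {u : Fin n → ℂ} {r : Fin n → ℤ} (h : pair u r = 0) : D u r ∈ DivZero n :=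
  Submodule.subset_span ⟨u, r, h, rfl⟩

lemma divZero_induction {n : ℕ} {p : DivZero n → Prop}
    (mem : ∀ u r (h : pair u r = 0), p (⟨D u r, D_mem h⟩ : DivZero n)) (zero : p 0)
    (add : ∀ x y, p x → p y → p (x + y)) (smul : ∀ (c : ℂ) x, p x → p (c • x))
    (x : DivZero n) : p x := by
  obtain ⟨x, hx⟩ := x
  refine Submodule.span_induction (p := fun x hx => p ⟨x, hx⟩) ?_ zero
    (fun x y hx hy => add ⟨x, hx⟩ ⟨y, hy⟩) (fun c x hx => smul c ⟨x, hx⟩) hx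
  rintro _ ⟨u, r, h, rfl⟩
  exact mem u r h

lemma D_mem_weyl {n : ℕ} (u : Fin n → ℂ) (r : Fin n → ℤ) :
    (D u r : Laurent n →ₗ[ℂ] Laurent n) ∈ Weyl n := by
  have h : (D u r : Laurent n →ₗ[ℂ] Laurent n) =
      LinearMap.mulLeft ℂ (mon r) *
        ∑ i, u i • (euler i : Laurent n →ₗ[ℂ] Laurent n) := by
    refine laurent_ext fun s => ?_
    simp only [Derivation.coeFn_coe, D_mon, Module.End.mul_apply, LinearMap.mulLeft_apply,
      LinearMap.sum_apply, LinearMap.smul_apply, euler_mon, smul_smul, ← Finset.sum_smul,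
      mul_smul_comm, mon_mul, pair]
  rw [h]
  exact mul_mem (Algebra.subset_adjoin (Or.inl ⟨_, rfl⟩))
    (sum_mem fun i _ =>
      Subalgebra.smul_mem (Weyl n) (Algebra.subset_adjoin (Or.inr ⟨i, rfl⟩)) (u i))

lemma divZero_mem_weyl {n : ℕ} (d : DivZero n) :
    (d.1 : Laurent n →ₗ[ℂ] Laurent n) ∈ Weyl n := by
  induction d using divZero_induction with
  | mem u r h => exact D_mem_weyl u r
  | zero => exact zero_mem (Weyl n)
  | add x y hx hy => exact add_mem hx hy
  | smul c x hx => exact Subalgebra.smul_mem _ hx c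

/-- A divergence zero vector field, seen as a differential operator in the Weyl algebra. -/
def Weyl.ofDivZero {n : ℕ} : DivZero n →ₗ[ℂ] Weyl n where
  toFun d := ⟨d.1, divZero_mem_weyl d⟩
  map_add' _ _ := rfl
  map_smul' _ _ := rfl

lemma Weyl.ofDivZero_lie {n : ℕ} (d e : DivZero n) :
    Weyl.ofDivZero ⁅d, e⁆ =
      Weyl.ofDivZero d * Weyl.ofDivZero e - Weyl.ofDivZero e * Weyl.ofDivZero d := rfl

lemma Weyl.ofLaurent_mul {n : ℕ} (f g : Laurent n) :
    Weyl.ofLaurent (f * g) = Weyl.ofLaurent f * Weyl.ofLaurent g := by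
  refine Subtype.ext (LinearMap.ext fun a => ?_)
  exact mul_assoc f g a

lemma Weyl.ofDivZero_mul_ofLaurent {n : ℕ} (d : DivZero n) (f : Laurent n) :
    Weyl.ofDivZero d * Weyl.ofLaurent f =
      Weyl.ofLaurent f * Weyl.ofDivZero d + Weyl.ofLaurent (d.1 f) := by
  refine Subtype.ext (LinearMap.ext fun a => ?_)
  change d.1 (f * a) = f * d.1 a + d.1 f * a
  rw [Derivation.leibniz, smul_eq_mul, smul_eq_mul, mul_comm a]

/-! ### `sl_n` and its fundamental modules -/

/-- The Lie algebra `sl_n` of complex traceless `n × n` matrices. -/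
abbrev sl (n : ℕ) : LieSubalgebra ℂ (Matrix (Fin n) (Fin n) ℂ) :=
  LieAlgebra.SpecialLinear.sl (Fin n) ℂ

/-- The `i`-th term `v ↦ v₁ ∧ ⋯ ∧ g vᵢ ∧ ⋯ ∧ v_k` of the action of an endomorphism `g` of `M` on
the `k`-th exterior power. -/
def extTerm {M : Type*} [AddCommGroup M] [Module ℂ M] (k : ℕ) (g : Module.End ℂ M) (i : Fin k) :
    MultilinearMap ℂ (fun _ : Fin k => M) (⋀[ℂ]^k M) :=
  (exteriorPower.ιMulti ℂ k).toMultilinearMap.compLinearMap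
    fun j => if j = i then g else LinearMap.id

lemma extTerm_apply {M : Type*} [AddCommGroup M] [Module ℂ M] {k : ℕ} (g : Module.End ℂ M)
    (i : Fin k) (v : Fin k → M) :
    extTerm k g i v = exteriorPower.ιMulti ℂ k (Function.update v i (g (v i))) := by
  change exteriorPower.ιMulti ℂ k _ = _
  congr 1
  funext j
  by_cases h : j = i
  · subst h; simp
  · simp [h]

/-- The alternating map
`(v₁, …, v_k) ↦ ∑ᵢ v₁ ∧ ⋯ ∧ v_{i-1} ∧ g vᵢ ∧ v_{i+1} ∧ ⋯ ∧ v_k`. -/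
def extAlt {M : Type*} [AddCommGroup M] [Module ℂ M] (k : ℕ) (g : Module.End ℂ M) :
    M [⋀^Fin k]→ₗ[ℂ] (⋀[ℂ]^k M) where
  __ := ∑ i, extTerm k g i
  map_eq_zero_of_eq' v a b hab hne := by
    change (∑ i, extTerm k g i) v = 0
    rw [sum_apply, Finset.sum_eq_add a b hne]
    · rw [extTerm_apply, extTerm_apply, ← hab]
      have h : Function.update v b (g (v a)) =
          Function.update v a (g (v a)) ∘ Equiv.swap a b := by
        funext j
        by_cases hj : j = a
        · subst hj
          simp [Function.update_of_ne hne, Function.update_of_ne hne.symm, hab]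
        · by_cases hj' : j = b
          · subst hj'; simp
          · simp [Function.update_of_ne hj', Function.update_of_ne hj,
              Equiv.swap_apply_of_ne_of_ne hj hj']
      rw [h, AlternatingMap.map_swap _ _ hne, add_neg_cancel]
    · intro c _ hc
      rw [extTerm_apply]
      refine AlternatingMap.map_eq_zero_of_eq _ _ (i := a) (j := b) ?_ hne
      rw [Function.update_of_ne hc.1.symm, Function.update_of_ne hc.2.symm, hab]
    · simp
    · simp

lemma extAlt_apply {M : Type*} [AddCommGroup M] [Module ℂ M] {k : ℕ} (g : Module.End ℂ M)
    (v : Fin k → M) :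
    extAlt k g v = ∑ i, exteriorPower.ιMulti ℂ k (Function.update v i (g (v i))) := by
  change (∑ i, extTerm k g i) v = _
  simp only [sum_apply, extTerm_apply]

/-- The action of an endomorphism `g` of `M` on the `k`-th exterior power,
`v₁ ∧ ⋯ ∧ v_k ↦ ∑ᵢ v₁ ∧ ⋯ ∧ v_{i-1} ∧ g vᵢ ∧ v_{i+1} ∧ ⋯ ∧ v_k`. -/
def extAct {M : Type*} [AddCommGroup M] [Module ℂ M] (k : ℕ) (g : Module.End ℂ M) :
    Module.End ℂ (⋀[ℂ]^k M) :=
  exteriorPower.alternatingMapLinearEquiv (extAlt k g)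

lemma extAct_ιMulti {M : Type*} [AddCommGroup M] [Module ℂ M] {k : ℕ} (g : Module.End ℂ M)
    (v : Fin k → M) :
    extAct k g (exteriorPower.ιMulti ℂ k v) =
      ∑ i, exteriorPower.ιMulti ℂ k (Function.update v i (g (v i))) := by
  rw [extAct, exteriorPower.alternatingMapLinearEquiv_apply_ιMulti, extAlt_apply]

lemma extAct_add {M : Type*} [AddCommGroup M] [Module ℂ M] {k : ℕ} (g h : Module.End ℂ M) :
    extAct k (g + h) = extAct k g + extAct k h := by
  refine exteriorPower.linearMap_ext (AlternatingMap.ext fun v => ?_)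
  simp [extAct_ιMulti, AlternatingMap.map_update_add, Finset.sum_add_distrib]

lemma extAct_smul {M : Type*} [AddCommGroup M] [Module ℂ M] {k : ℕ} (c : ℂ)
    (g : Module.End ℂ M) : extAct k (c • g) = c • extAct k g := by
  refine exteriorPower.linearMap_ext (AlternatingMap.ext fun v => ?_)
  simp [extAct_ιMulti, AlternatingMap.map_update_smul, Finset.smul_sum]

lemma extAct_lie {M : Type*} [AddCommGroup M] [Module ℂ M] {k : ℕ} (g h : Module.End ℂ M) :
    extAct k ⁅g, h⁆ = ⁅extAct k g, extAct k h⁆ := by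
  refine exteriorPower.linearMap_ext (AlternatingMap.ext fun v => ?_)
  change extAct k (g * h - h * g) (exteriorPower.ιMulti ℂ k v) =
    extAct k g (extAct k h (exteriorPower.ιMulti ℂ k v)) -
      extAct k h (extAct k g (exteriorPower.ιMulti ℂ k v))
  simp only [LinearMap.sub_apply,
    Module.End.mul_apply, extAct_ιMulti, map_sum, AlternatingMap.map_update_sub]
  rw [Finset.sum_comm (s := Finset.univ) (t := Finset.univ)
    (f := fun x x_1 => exteriorPower.ιMulti ℂ k
      (Function.update (Function.update v x (g (v x))) x_1
        (h (Function.update v x (g (v x)) x_1)))), ← Finset.sum_sub_distrib]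
  refine Finset.sum_congr rfl fun i _ => ?_
  rw [← Finset.sum_sub_distrib, Finset.sum_eq_single i]
  · simp
  · intro j _ hj
    rw [Function.update_of_ne hj, Function.update_of_ne hj.symm, Function.update_comm hj.symm,
      sub_self]
  · simp

/-- The fundamental `sl_n`-module `V(δ_k)`, realised as the `k`-th exterior power of the natural
module `ℂⁿ`; for `k = 0` this is the one-dimensional trivial module. -/
def Fund (n k : ℕ) : Type := ⋀[ℂ]^k (Fin n → ℂ)

instance (n k : ℕ) : AddCommGroup (Fund n k) :=
  inferInstanceAs (AddCommGroup (⋀[ℂ]^k (Fin n → ℂ)))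

instance (n k : ℕ) : Module ℂ (Fund n k) :=
  inferInstanceAs (Module ℂ (⋀[ℂ]^k (Fin n → ℂ)))

/-- The action of `sl_n` on `V(δ_k)`: the natural action of matrices on column vectors, extended
to the exterior power. -/
def fundAct (n k : ℕ) : sl n →ₗ⁅ℂ⁆ Module.End ℂ (Fund n k) where
  toFun X := extAct k (Matrix.toLin' X.1)
  map_add' X Y := by
    exact Eq.trans (congrArg (extAct k) (map_add Matrix.toLin' X.1 Y.1)) (extAct_add _ _)
  map_smul' c X := by
    exact Eq.trans (congrArg (extAct k) (map_smul Matrix.toLin' c X.1)) (extAct_smul _ _)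
  map_lie' {X Y} := by
    refine Eq.trans ?_ (extAct_lie _ _)
    congr 1
    rw [LieAlgebra.SpecialLinear.sl_bracket, map_sub, Matrix.toLin'_mul, Matrix.toLin'_mul]
    rfl

instance (n k : ℕ) : LieRingModule (sl n) (Fund n k) where
  bracket X w := fundAct n k X w
  add_lie X Y w := by simp only [map_add, LinearMap.add_apply]
  lie_add X w w' := by simp only [map_add]
  leibniz_lie X Y w := by
    simp only [LieHom.map_lie, Ring.lie_def, LinearMap.sub_apply, Module.End.mul_apply,
      sub_add_cancel]

instance (n k : ℕ) : LieModule ℂ (sl n) (Fund n k) where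
  smul_lie c X w := by
    change fundAct n k (c • X) w = c • fundAct n k X w
    rw [map_smul, LinearMap.smul_apply]
  lie_smul c X w := map_smul (fundAct n k X) c w

/-! ### The `𝕊_n`-module `F(P, V)` -/

/-- The projection `gl_n → sl_n`, `M ↦ M - (tr M / n) I`. -/
def toSl (n : ℕ) : Matrix (Fin n) (Fin n) ℂ →ₗ[ℂ] sl n :=
  LinearMap.codRestrict (sl n).toSubmodule
    (LinearMap.id - (Matrix.traceLinearMap (Fin n) ℂ ℂ).smulRight
      ((n : ℂ)⁻¹ • (1 : Matrix (Fin n) (Fin n) ℂ))) (by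
    intro M
    change M - M.trace • ((n : ℂ)⁻¹ • (1 : Matrix (Fin n) (Fin n) ℂ)) ∈
      LinearMap.ker (Matrix.traceLinearMap (Fin n) ℂ ℂ)
    rw [LinearMap.mem_ker, Matrix.traceLinearMap_apply, Matrix.trace_sub, Matrix.trace_smul,
      Matrix.trace_smul, Matrix.trace_one, Fintype.card_fin]
    rcases Nat.eq_zero_or_pos n with rfl | h
    · simp
    · have : (n : ℂ) ≠ 0 := by exact_mod_cast h.ne'
      simp [this])

lemma toSl_of_trace {n : ℕ} (M : Matrix (Fin n) (Fin n) ℂ) (h : M ∈ sl n) :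
    toSl n M = ⟨M, h⟩ := by
  have h' : M.trace = 0 := h
  refine Subtype.ext ?_
  change M - M.trace • ((n : ℂ)⁻¹ • (1 : Matrix (Fin n) (Fin n) ℂ)) = M
  rw [h', zero_smul, sub_zero]

/-- The rank one matrix `r uᵀ`, for `r ∈ ℤⁿ` and `u ∈ ℂⁿ`. -/
def outer {n : ℕ} (r : Fin n → ℤ) (u : Fin n → ℂ) : Matrix (Fin n) (Fin n) ℂ :=
  Matrix.vecMulVec (fun i => (r i : ℂ)) u

lemma outer_mem {n : ℕ} {r : Fin n → ℤ} {u : Fin n → ℂ} (h : pair u r = 0) :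
    outer r u ∈ sl n := by
  change Matrix.trace (outer r u) = 0
  rw [← h, outer, Matrix.trace_vecMulVec, dotProduct, pair]
  exact Finset.sum_congr rfl fun i _ => mul_comm _ _

/-- The `j`-th component `f_j = x_j⁻¹ d(x_j)` of a vector field `d = ∑_j f_j ∂_j`. -/
def comp {n : ℕ} (j : Fin n) : Witt n →ₗ[ℂ] Laurent n where
  toFun d := mon (-Pi.single j 1) * d (mon (Pi.single j 1))
  map_add' d e := by rw [Derivation.add_apply, mul_add]
  map_smul' c d := by rw [Derivation.smul_apply, mul_smul_comm, RingHom.id_apply]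

lemma comp_D {n : ℕ} (j : Fin n) (u : Fin n → ℂ) (r : Fin n → ℤ) :
    comp j (D u r) = u j • mon r := by
  change mon _ * D u r (mon _) = _
  rw [D_mon, mul_smul_comm, mon_mul]
  congr 1
  · rw [pair, Finset.sum_eq_single j]
    · simp
    · intro b _ hb; simp [hb]
    · simp
  · congr 1; abel

section

variable (n : ℕ) (P V : Type*) [AddCommGroup P] [Module ℂ P] [Module (Weyl n) P]
  [IsScalarTower ℂ (Weyl n) P] [AddCommGroup V] [Module ℂ V]

/-- The `𝕊_n`-module `F(P, V) = P ⊗ V`. -/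
def F (P V : Type*) [AddCommGroup P] [Module ℂ P] [AddCommGroup V] [Module ℂ V] : Type _ :=
  P ⊗[ℂ] V

instance (P V : Type*) [AddCommGroup P] [Module ℂ P] [AddCommGroup V] [Module ℂ V] :
    AddCommGroup (F P V) := inferInstanceAs (AddCommGroup (P ⊗[ℂ] V))

instance (P V : Type*) [AddCommGroup P] [Module ℂ P] [AddCommGroup V] [Module ℂ V] :
    Module ℂ (F P V) := inferInstanceAs (Module ℂ (P ⊗[ℂ] V))

/-- The operator `z ⊗ y ↦ a z ⊗ g y` on `P ⊗ V`, bilinear in `a ∈ K_n` and `g`. -/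
def opTensor : Weyl n →ₗ[ℂ] Module.End ℂ V →ₗ[ℂ] Module.End ℂ (P ⊗[ℂ] V) :=
  (TensorProduct.mapBilinear (RingHom.id ℂ) P V P V) ∘ₗ (Algebra.lsmul ℂ ℂ P).toLinearMap

lemma opTensor_tmul (a : Weyl n) (g : Module.End ℂ V) (z : P) (y : V) :
    opTensor n P V a g (z ⊗ₜ y) = (a • z) ⊗ₜ g y := rfl

lemma opTensor_mul (a b : Weyl n) (g h : Module.End ℂ V) :
    opTensor n P V a g * opTensor n P V b h = opTensor n P V (a * b) (g * h) := by
  refine TensorProduct.ext' fun z y => ?_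
  rw [Module.End.mul_apply, opTensor_tmul, opTensor_tmul, opTensor_tmul, mul_smul,
    Module.End.mul_apply]

variable [LieRingModule (sl n) V] [LieModule ℂ (sl n) V]

/-- The action of matrices on `V`, where `V` is made into a `gl_n`-module on which the identity
matrix acts as zero. -/
def glAct : Matrix (Fin n) (Fin n) ℂ →ₗ[ℂ] Module.End ℂ V :=
  (LieModule.toEnd ℂ (sl n) V : sl n →ₗ[ℂ] Module.End ℂ V) ∘ₗ toSl n

/-- The action of `d = ∑_j f_j ∂_j ∈ 𝕊_n` on `F(P, V)`:
`d (z ⊗ y) = d z ⊗ y + ∑_{i,j} (∂_i f_j) z ⊗ E_{ij} y`.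
The divergence `∑_i ∂_i f_i` of `d` vanishes, so only the action of `sl_n` on `V` enters. By
`act_D` this is the linear extension of
`D(u, r) (z ⊗ y) = D(u, r) z ⊗ y + x^r z ⊗ (r uᵀ) y` (where `(u | r) = 0`). -/
def act : DivZero n →ₗ[ℂ] Module.End ℂ (P ⊗[ℂ] V) where
  toFun d := opTensor n P V (Weyl.ofDivZero d) LinearMap.id +
    ∑ i, ∑ j, opTensor n P V (Weyl.ofLaurent (euler i (comp j d.1)))
      (glAct n V (Matrix.single i j 1))
  map_add' d e := by
    have h : ∀ i j : Fin n, euler i (comp j (d + e).1) =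
        euler i (comp j d.1) + euler i (comp j e.1) := fun i j => by
      rw [← Derivation.map_add, ← map_add]; rfl
    simp only [h, map_add, LinearMap.add_apply, Finset.sum_add_distrib]
    abel
  map_smul' c d := by
    have h : ∀ i j : Fin n, euler i (comp j (c • d).1) = c • euler i (comp j d.1) :=
      fun i j => by rw [← Derivation.map_smul, ← map_smul]; rfl
    simp only [h, map_smul, LinearMap.smul_apply, RingHom.id_apply, smul_add, Finset.smul_sum]

lemma act_D' {u : Fin n → ℂ} {r : Fin n → ℤ} (h : pair u r = 0) :
    act n P V ⟨D u r, D_mem h⟩ =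
      opTensor n P V (Weyl.ofDivZero ⟨D u r, D_mem h⟩) LinearMap.id +
      opTensor n P V (Weyl.ofLaurent (mon r))
        (LieModule.toEnd ℂ (sl n) V ⟨outer r u, outer_mem h⟩) := by
  refine congrArg (opTensor n P V (Weyl.ofDivZero ⟨D u r, D_mem h⟩) LinearMap.id + ·) ?_
  have h₁ : LieModule.toEnd ℂ (sl n) V ⟨outer r u, outer_mem h⟩ = glAct n V (outer r u) := by
    rw [glAct, LinearMap.comp_apply, toSl_of_trace _ (outer_mem h)]; rfl
  have h₂ : outer r u = ∑ i, ∑ j, ((r i : ℂ) * u j) • Matrix.single i j (1 : ℂ) := by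
    conv_lhs => rw [Matrix.matrix_eq_sum_single (outer r u)]
    simp [outer, Matrix.vecMulVec_apply, Matrix.smul_single]
  rw [h₁, h₂]
  simp only [map_sum, map_smul, comp_D, Derivation.map_smul, euler_mon, smul_smul,
    LinearMap.smul_apply, mul_comm]

/-- `D(u, r) (z ⊗ y) = D(u, r) z ⊗ y + x^r z ⊗ (r uᵀ) y` whenever `(u | r) = 0`. -/
lemma act_D {u : Fin n → ℂ} {r : Fin n → ℤ} (h : pair u r = 0) (z : P) (y : V) :
    act n P V ⟨D u r, D_mem h⟩ (z ⊗ₜ y) =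
      (Weyl.ofDivZero ⟨D u r, D_mem h⟩ • z) ⊗ₜ y +
        (Weyl.ofLaurent (mon r) • z) ⊗ₜ ⁅(⟨outer r u, outer_mem h⟩ : sl n), y⁆ := by
  rw [act_D' n P V h]; rfl

lemma outer_identity {u v : Fin n → ℂ} {r s : Fin n → ℤ} :
    outer (r + s) (pair u s • v - pair v r • u) =
      pair u s • outer s v - pair v r • outer r u + ⁅outer r u, outer s v⁆ := by
  have h : ∀ (u v : Fin n → ℂ) (r s : Fin n → ℤ),
      outer r u * outer s v = pair u s • outer r v := by
    intro u v r s
    ext i j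
    simp only [outer, Matrix.mul_apply, Matrix.vecMulVec_apply, Matrix.smul_apply, pair,
      smul_eq_mul, Finset.sum_mul]
    exact Finset.sum_congr rfl fun k _ => by ring
  rw [Ring.lie_def, h, h]
  ext i j
  simp only [outer, Matrix.vecMulVec_apply, Matrix.smul_apply, Matrix.sub_apply,
    Matrix.add_apply, smul_eq_mul, Pi.add_apply, Pi.sub_apply, Pi.smul_apply, Int.cast_add]
  ring

lemma act_lie (d e : DivZero n) :
    act n P V ⁅d, e⁆ = act n P V d * act n P V e - act n P V e * act n P V d := by
  induction d using divZero_induction with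
  | zero => simp
  | add x y hx hy => rw [add_lie, map_add, map_add, hx, hy, add_mul, mul_add]; abel
  | smul c x hx =>
    rw [smul_lie, map_smul, map_smul, hx, smul_mul_assoc, mul_smul_comm, smul_sub]
  | mem u r hu =>
  induction e using divZero_induction with
  | zero => simp
  | add x y hx hy => rw [lie_add, map_add, map_add, hx, hy, add_mul, mul_add]; abel
  | smul c x hx =>
    rw [lie_smul, map_smul, map_smul, hx, smul_mul_assoc, mul_smul_comm, smul_sub]
  | mem v s hv =>
  have hw : pair (pair u s • v - pair v r • u) (r + s) = 0 := by
    rw [pair_smul_sub_smul, pair_add, pair_add, hu, hv]; ring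
  have hl : ⁅(⟨D u r, D_mem hu⟩ : DivZero n), (⟨D v s, D_mem hv⟩ : DivZero n)⁆ =
      ⟨D (pair u s • v - pair v r • u) (r + s), D_mem hw⟩ := Subtype.ext (lie_D u v r s)
  have ho : (⟨outer (r + s) (pair u s • v - pair v r • u), outer_mem hw⟩ : sl n) =
      pair u s • ⟨outer s v, outer_mem hv⟩ - pair v r • ⟨outer r u, outer_mem hu⟩ +
        ⁅(⟨outer r u, outer_mem hu⟩ : sl n), (⟨outer s v, outer_mem hv⟩ : sl n)⁆ :=
    Subtype.ext (outer_identity n)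
  have h₁ := Weyl.ofDivZero_mul_ofLaurent (⟨D u r, D_mem hu⟩ : DivZero n) (mon s)
  have h₂ := Weyl.ofDivZero_mul_ofLaurent (⟨D v s, D_mem hv⟩ : DivZero n) (mon r)
  rw [D_mon] at h₁ h₂
  have h₃ : Weyl.ofDivZero (⟨D (pair u s • v - pair v r • u) (r + s), D_mem hw⟩ : DivZero n) =
      Weyl.ofDivZero ⟨D u r, D_mem hu⟩ * Weyl.ofDivZero ⟨D v s, D_mem hv⟩ -
        Weyl.ofDivZero ⟨D v s, D_mem hv⟩ * Weyl.ofDivZero ⟨D u r, D_mem hu⟩ := by rw [← hl, Weyl.ofDivZero_lie]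
  rw [hl]
  rw [act_D' n P V hu, act_D' n P V hv, act_D' n P V hw, ho, h₃, ← Module.End.one_eq_id]
  simp only [LieHom.map_lie, Ring.lie_def, mul_add, add_mul, opTensor_mul, one_mul, mul_one, h₁, h₂, ← Weyl.ofLaurent_mul,
    mon_mul, add_comm s r, map_add, map_sub, map_smul, LinearMap.add_apply,
    LinearMap.smul_apply, LinearMap.sub_apply]
  abel

end

/-- The Lie action of `𝕊_n` on `F(P, V)`. -/
instance (n : ℕ) (P V : Type*) [AddCommGroup P] [Module ℂ P] [Module (Weyl n) P]
    [IsScalarTower ℂ (Weyl n) P] [AddCommGroup V] [Module ℂ V] [LieRingModule (sl n) V]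
    [LieModule ℂ (sl n) V] : LieRingModule (DivZero n) (F P V) where
  bracket d w := act n P V d w
  add_lie d e w := by rw [map_add]; rfl
  lie_add d w w' := map_add (act n P V d) w w'
  leibniz_lie d e w := by
    rw [act_lie]
    exact (sub_add_cancel (act n P V d (act n P V e w)) (act n P V e (act n P V d w))).symm

instance (n : ℕ) (P V : Type*) [AddCommGroup P] [Module ℂ P] [Module (Weyl n) P]
    [IsScalarTower ℂ (Weyl n) P] [AddCommGroup V] [Module ℂ V] [LieRingModule (sl n) V]
    [LieModule ℂ (sl n) V] : LieModule ℂ (DivZero n) (F P V) where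
  smul_lie c d w := by
    change act n P V (c • d) w = c • act n P V d w
    rw [map_smul]; rfl
  lie_smul c d w := map_smul (act n P V d) c w

end

end TorusFields

/-!
Write `ρ` for the action of `gl_n` on `V` in which the identity matrix acts as zero, so that
`D(u, r)` acts on `P ⊗ V` as `x^r (∂_u ⊗ 1 + 1 ⊗ ρ(r uᵀ))`. Let `N` be a nonzero `𝕊_n`-submodule.

The argument rests on the operators `x^m ⊗ ρ(E_ij)²` with `i ≠ j`. The product of the actions of
`D(e_j, t e_i)` and `D((m_i - t) e_j - m_j e_i, m - t e_i)` is a cubic polynomial in the integer `t`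
with leading coefficient `x^m ⊗ ρ(E_ij)²`; taking third differences, `N` is stable under all these
operators (`opMon_mul_opRight_sq_mem_stabilizer`).

If some `ρ(E_ij)²` is nonzero, let `N₁` be the largest subspace of `N` stable under multiplication
by monomials. It is stable under the `D(u, r)`, hence under all `x^r`, `∂_i` and `E_ij`. It is
nonzero: the set `Q` of operators `g` on `V` such that all `x^m ⊗ g` preserve `N` is stable under
commutators with the `ρ(E_ij)`, so the common kernel of `Q` is a submodule of `V`, and it is not `V`;
hence some `1 ⊗ g` with `g ∈ Q` does not vanish on `N`, and it maps `N` into `N₁`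
(`monCore_ne_bot`). Thus `N₁` is a nonzero submodule of `P ⊗ V` for `K_n` and `sl_n`. The algebra
`K_n` has countable dimension, so its endomorphisms of `P` are scalars, and the density theorem gives
`N₁ = P ⊗ V` (`eq_top_of_opLeft_opRight_stable`).

If all `ρ(E_ij)²` vanish, then `H = ρ(E_ii - E_jj)` satisfies `H³ = H`, so `V` contains a common
eigenvector of the diagonal matrices. Its weight is that of `e_S = ⋀_{i ∈ S} e_i` for a proper subset
`S` of the set of indices, and `E_ij` kills it unless `i ∉ S` and `j ∈ S`
(`exists_isSubsetWeight`). For the grading of `gl_n` by the diagonal matrix with ones at the places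
in `S`, the vector is of highest weight, with the same weight as `e_S`. Since `V` and `⋀^|S| ℂⁿ` are
irreducible, they are isomorphic (`exists_equiv_fund`), which the hypothesis on `V` excludes.
-/

namespace TorusFields

open scoped TensorProduct

attribute [local instance 100] LieRing.ofAssociativeRing

/-! ### Irreducible representations with a common highest weight -/

section HighestWeight

variable {L : Type*} [LieRing L] [LieAlgebra ℂ L]

/-- The degree `d` part of the subrepresentation generated by `x`: the span of the vectors
`X₁ ⋯ X_d x` with all `Xᵢ` of degree `-1` for the grading of `L` by the eigenvalues of `ad h`. -/
def lowered {M : Type*} [AddCommGroup M] [Module ℂ M] (τ : L →ₗ⁅ℂ⁆ Module.End ℂ M) (h : L)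
    (x : M) : ℕ → Submodule ℂ M
  | 0 => ℂ ∙ x
  | d + 1 => Submodule.span ℂ {z | ∃ X y, ⁅h, X⁆ = -X ∧ y ∈ lowered τ h x d ∧ z = τ X y}

lemma rep_swap {M : Type*} [AddCommGroup M] [Module ℂ M] (τ : L →ₗ⁅ℂ⁆ Module.End ℂ M) (X Y : L)
    (y : M) : τ X (τ Y y) = τ ⁅X, Y⁆ y + τ Y (τ X y) := by
  simp [LieHom.map_lie, Ring.lie_def]

/-- For `L = L₋₁ ⊕ L₀ ⊕ L₁` and a vector `x` killed by `L₁` on which `L₀` acts through scalars,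
the subrepresentation generated by `x` meets the `h`-weight space of `x` in the line of `x`. -/
lemma exists_stable_of_highest {M : Type*} [AddCommGroup M] [Module ℂ M]
    (τ : L →ₗ⁅ℂ⁆ Module.End ℂ M) (h : L)
    (hL : ∀ X : L, ∃ A B C, X = A + B + C ∧ ⁅h, A⁆ = -A ∧ ⁅h, B⁆ = 0 ∧ ⁅h, C⁆ = C)
    (x : M) (h₁ : ∀ X, ⁅h, X⁆ = X → τ X x = 0)
    (h₀ : ∀ X, ⁅h, X⁆ = 0 → ∃ c : ℂ, τ X x = c • x) :
    ∃ G : Submodule ℂ M, x ∈ G ∧ (∀ X, ∀ y ∈ G, τ X y ∈ G) ∧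
      ∀ c : ℂ, τ h x = c • x → ∀ y ∈ G, τ h y = c • y → ∃ a : ℂ, y = a • x := by
  set Dg := lowered τ h x with hDg
  have hneg : ∀ d X, ⁅h, X⁆ = -X → ∀ y ∈ Dg d, τ X y ∈ Dg (d + 1) := fun d X hX y hy =>
    Submodule.subset_span ⟨X, y, hX, hy, rfl⟩
  have hzero : ∀ d X, ⁅h, X⁆ = 0 → ∀ y ∈ Dg d, τ X y ∈ Dg d := by
    intro d
    induction d with
    | zero =>
      intro X hX y hy
      obtain ⟨a, rfl⟩ := Submodule.mem_span_singleton.1 hy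
      obtain ⟨c, hc⟩ := h₀ X hX
      rw [map_smul, hc]
      exact Submodule.smul_mem _ _ (Submodule.smul_mem _ _ (Submodule.mem_span_singleton_self x))
    | succ d ih =>
      intro X hX y hy
      refine Submodule.span_induction (p := fun y _ => τ X y ∈ Dg (d + 1)) ?_ ?_ ?_ ?_ hy
      · rintro _ ⟨Y, y, hY, hy, rfl⟩
        rw [rep_swap]
        refine add_mem (hneg d _ ?_ y hy) (hneg d Y hY _ (ih X hX y hy))
        rw [leibniz_lie, hX, hY, zero_lie, lie_neg, zero_add]
      · simp
      · intro y z _ _ hy hz; rw [map_add]; exact add_mem hy hz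
      · intro a y _ hy; rw [map_smul]; exact Submodule.smul_mem _ _ hy
  have hle : ∀ d, Dg d ≤ ⨆ d, Dg d := le_iSup Dg
  have gneg : ∀ X, ⁅h, X⁆ = -X → ∀ y ∈ ⨆ d, Dg d, τ X y ∈ ⨆ d, Dg d := by
    intro X hX y hy
    refine Submodule.iSup_induction Dg (motive := fun y => τ X y ∈ ⨆ d, Dg d) hy
      (fun d y hy => hle _ (hneg d X hX y hy)) (by simp)
      (fun y z hy hz => by rw [map_add]; exact add_mem hy hz)
  have gzero : ∀ X, ⁅h, X⁆ = 0 → ∀ y ∈ ⨆ d, Dg d, τ X y ∈ ⨆ d, Dg d := by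
    intro X hX y hy
    refine Submodule.iSup_induction Dg (motive := fun y => τ X y ∈ ⨆ d, Dg d) hy
      (fun d y hy => hle _ (hzero d X hX y hy)) (by simp)
      (fun y z hy hz => by rw [map_add]; exact add_mem hy hz)
  have hpos : ∀ d X, ⁅h, X⁆ = X → ∀ y ∈ Dg d, τ X y ∈ ⨆ d, Dg d := by
    intro d
    induction d with
    | zero =>
      intro X hX y hy
      obtain ⟨a, rfl⟩ := Submodule.mem_span_singleton.1 hy
      rw [map_smul, h₁ X hX, smul_zero]
      exact zero_mem _
    | succ d ih =>
      intro X hX y hy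
      refine Submodule.span_induction (p := fun y _ => τ X y ∈ ⨆ d, Dg d) ?_ ?_ ?_ ?_ hy
      · rintro _ ⟨Y, y, hY, hy, rfl⟩
        rw [rep_swap]
        refine add_mem (hle d (hzero d _ ?_ y hy)) (gneg Y hY _ (ih X hX y hy))
        rw [leibniz_lie, hX, hY, lie_neg, add_neg_cancel]
      · simp
      · intro y z _ _ hy hz; rw [map_add]; exact add_mem hy hz
      · intro a y _ hy; rw [map_smul]; exact Submodule.smul_mem _ _ hy
  have gpos : ∀ X, ⁅h, X⁆ = X → ∀ y ∈ ⨆ d, Dg d, τ X y ∈ ⨆ d, Dg d := by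
    intro X hX y hy
    refine Submodule.iSup_induction Dg (motive := fun y => τ X y ∈ ⨆ d, Dg d) hy
      (fun d y hy => hpos d X hX y hy) (by simp)
      (fun y z hy hz => by rw [map_add]; exact add_mem hy hz)
  refine ⟨⨆ d, Dg d, hle 0 (Submodule.mem_span_singleton_self x), ?_, ?_⟩
  · intro X y hy
    obtain ⟨A, B, C, rfl, hA, hB, hC⟩ := hL X
    simp only [map_add, LinearMap.add_apply]
    exact add_mem (add_mem (gneg A hA y hy) (gzero B hB y hy)) (gpos C hC y hy)
  · intro c hc y hy hyc
    have heig : ∀ d, ∀ y ∈ Dg d, τ h y = (c - d) • y := by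
      intro d
      induction d with
      | zero =>
        intro y hy
        obtain ⟨a, rfl⟩ := Submodule.mem_span_singleton.1 hy
        rw [map_smul, hc, smul_comm]; simp
      | succ d ih =>
        intro y hy
        refine Submodule.span_induction (p := fun y _ => τ h y = (c - (d + 1 : ℕ)) • y)
          ?_ ?_ ?_ ?_ hy
        · rintro _ ⟨Y, y, hY, hy, rfl⟩
          rw [rep_swap, hY, ih y hy, map_smul, map_neg, LinearMap.neg_apply]
          push_cast
          module
        · simp
        · intro y z _ _ hy hz; rw [map_add, hy, hz, smul_add]
        · intro a y _ hy; rw [map_smul, hy, smul_comm]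
    -- Only the degree `0` part of `G` lies in the `c`-eigenspace of `h`.
    have hdec : (⨆ d, Dg d) ≤ (ℂ ∙ x) ⊔ ⨆ μ, ⨆ (_ : μ ≠ c), (τ h).eigenspace μ := by
      refine iSup_le fun d => ?_
      rcases Nat.eq_zero_or_pos d with rfl | hd
      · exact le_sup_left
      · refine le_trans (fun y hy => Module.End.mem_eigenspace_iff.2 (heig d y hy))
          (le_trans ?_ le_sup_right)
        refine le_iSup₂_of_le (c - d) ?_ le_rfl
        have : (d : ℂ) ≠ 0 := by exact_mod_cast hd.ne'
        simpa using this
    obtain ⟨y₀, hy₀, z, hz, rfl⟩ := Submodule.mem_sup.1 (hdec hy)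
    obtain ⟨a, rfl⟩ := Submodule.mem_span_singleton.1 hy₀
    have hzc : z ∈ (τ h).eigenspace c := by
      rw [Module.End.mem_eigenspace_iff]
      rw [map_add, map_smul, hc, smul_add, smul_comm] at hyc
      exact add_left_cancel hyc
    have := (Module.End.eigenspaces_iSupIndep (τ h) c).le_bot ⟨hzc, hz⟩
    rw [Submodule.mem_bot] at this
    exact ⟨a, by rw [this, add_zero]⟩

/-- Irreducible representations with highest weight vectors `v`, `w` of the same weight are
isomorphic: the subrepresentation of the direct sum generated by `(v, w)` is the graph of an
isomorphism. -/
theorem exists_equiv_of_common_highest {V W : Type*} [AddCommGroup V] [Module ℂ V]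
    [AddCommGroup W] [Module ℂ W] (ρ : L →ₗ⁅ℂ⁆ Module.End ℂ V) (σ : L →ₗ⁅ℂ⁆ Module.End ℂ W)
    (hV : ∀ N : Submodule ℂ V, (∀ X, ∀ y ∈ N, ρ X y ∈ N) → N = ⊥ ∨ N = ⊤)
    (hW : ∀ N : Submodule ℂ W, (∀ X, ∀ y ∈ N, σ X y ∈ N) → N = ⊥ ∨ N = ⊤) (h : L)
    (hL : ∀ X : L, ∃ A B C, X = A + B + C ∧ ⁅h, A⁆ = -A ∧ ⁅h, B⁆ = 0 ∧ ⁅h, C⁆ = C)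
    {v : V} {w : W} (hv : v ≠ 0) (hw : w ≠ 0)
    (h₁ : ∀ X, ⁅h, X⁆ = X → ρ X v = 0 ∧ σ X w = 0)
    (h₀ : ∀ X, ⁅h, X⁆ = 0 → ∃ c : ℂ, ρ X v = c • v ∧ σ X w = c • w) :
    ∃ φ : V ≃ₗ[ℂ] W, ∀ X y, φ (ρ X y) = σ X (φ y) := by
  let τ : L →ₗ⁅ℂ⁆ Module.End ℂ (V × W) :=
    { toFun := fun X => (ρ X).prodMap (σ X)
      map_add' := fun X Y => by ext <;> simp
      map_smul' := fun c X => by ext <;> simp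
      map_lie' := fun {X Y} => by ext <;> simp [LieHom.map_lie, Ring.lie_def] }
  have hτ : ∀ X y z, τ X (y, z) = (ρ X y, σ X z) := fun _ _ _ => rfl
  obtain ⟨G, hxG, hG, hline⟩ := exists_stable_of_highest τ h hL (v, w)
    (fun X hX => by rw [hτ, (h₁ X hX).1, (h₁ X hX).2]; rfl)
    (fun X hX => by
      obtain ⟨c, hc, hc'⟩ := h₀ X hX
      exact ⟨c, by rw [hτ, hc, hc']; rfl⟩)
  obtain ⟨c, hcv, hcw⟩ := h₀ h (lie_self h)
  have hc : τ h (v, w) = c • (v, w) := by rw [hτ, hcv, hcw]; rfl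
  have hker₂ : ∀ z, ((0 : V), z) ∈ G → z = 0 := by
    rcases hW (G.comap (LinearMap.inr ℂ V W)) (fun X z hz => by
      have := hG X _ hz
      simpa [hτ] using this) with hb | ht
    · intro z hz
      have : z ∈ G.comap (LinearMap.inr ℂ V W) := hz
      rwa [hb, Submodule.mem_bot] at this
    · exfalso
      have hm : w ∈ G.comap (LinearMap.inr ℂ V W) := ht ▸ Submodule.mem_top
      obtain ⟨a, ha⟩ := hline c hc (0, w) hm (by rw [hτ, hcw]; simp)
      simp only [Prod.smul_mk, Prod.mk.injEq] at ha
      rcases smul_eq_zero.1 ha.1.symm with rfl | h'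
      · exact hw (by simpa using ha.2)
      · exact hv h'
  have hker₁ : ∀ y, (y, (0 : W)) ∈ G → y = 0 := by
    rcases hV (G.comap (LinearMap.inl ℂ V W)) (fun X z hz => by
      have := hG X _ hz
      simpa [hτ] using this) with hb | ht
    · intro z hz
      have : z ∈ G.comap (LinearMap.inl ℂ V W) := hz
      rwa [hb, Submodule.mem_bot] at this
    · exfalso
      have hm : v ∈ G.comap (LinearMap.inl ℂ V W) := ht ▸ Submodule.mem_top
      obtain ⟨a, ha⟩ := hline c hc (v, 0) hm (by rw [hτ, hcv]; simp)
      simp only [Prod.smul_mk, Prod.mk.injEq] at ha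
      rcases smul_eq_zero.1 ha.2.symm with rfl | h'
      · exact hv (by simpa using ha.1)
      · exact hw h'
  have hsurj₁ : G.map (LinearMap.fst ℂ V W) = ⊤ := by
    refine (hV _ ?_).resolve_left fun hb => hv ?_
    · rintro X _ ⟨g, hg, rfl⟩
      exact ⟨τ X g, hG X g hg, rfl⟩
    · have : v ∈ G.map (LinearMap.fst ℂ V W) := ⟨_, hxG, rfl⟩
      rwa [hb, Submodule.mem_bot] at this
  have hsurj₂ : G.map (LinearMap.snd ℂ V W) = ⊤ := by
    refine (hW _ ?_).resolve_left fun hb => hw ?_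
    · rintro X _ ⟨g, hg, rfl⟩
      exact ⟨τ X g, hG X g hg, rfl⟩
    · have : w ∈ G.map (LinearMap.snd ℂ V W) := ⟨_, hxG, rfl⟩
      rwa [hb, Submodule.mem_bot] at this
  have b₁ : Function.Bijective (LinearMap.fst ℂ V W ∘ₗ G.subtype) := by
    refine ⟨(injective_iff_map_eq_zero _).2 ?_, fun y => ?_⟩
    · rintro ⟨⟨y, z⟩, hg⟩ (rfl : y = 0)
      exact Subtype.ext (Prod.ext rfl (hker₂ z hg))
    · obtain ⟨g, hg, rfl⟩ : y ∈ G.map (LinearMap.fst ℂ V W) := hsurj₁ ▸ Submodule.mem_top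
      exact ⟨⟨g, hg⟩, rfl⟩
  have b₂ : Function.Bijective (LinearMap.snd ℂ V W ∘ₗ G.subtype) := by
    refine ⟨(injective_iff_map_eq_zero _).2 ?_, fun y => ?_⟩
    · rintro ⟨⟨y, z⟩, hg⟩ (rfl : z = 0)
      exact Subtype.ext (Prod.ext (hker₁ y hg) rfl)
    · obtain ⟨g, hg, rfl⟩ : y ∈ G.map (LinearMap.snd ℂ V W) := hsurj₂ ▸ Submodule.mem_top
      exact ⟨⟨g, hg⟩, rfl⟩
  let e₁ := LinearEquiv.ofBijective _ b₁
  let e₂ := LinearEquiv.ofBijective _ b₂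
  refine ⟨e₁.symm.trans e₂, fun X y => ?_⟩
  obtain ⟨g, rfl⟩ := e₁.surjective y
  have : ρ X (e₁ g) = e₁ ⟨τ X g, hG X g g.2⟩ := rfl
  rw [this, LinearEquiv.trans_apply, LinearEquiv.trans_apply, LinearEquiv.symm_apply_apply,
    LinearEquiv.symm_apply_apply]
  rfl

end HighestWeight

/-! ### `sl_n`-modules as representations of `gl_n` -/

section GeneralLinear

variable (n : ℕ) (V : Type*) [AddCommGroup V] [Module ℂ V] [LieRingModule (sl n) V]
  [LieModule ℂ (sl n) V]

lemma toSl_coe_eq_sub (A : Matrix (Fin n) (Fin n) ℂ) :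
    ((toSl n A : sl n) : Matrix (Fin n) (Fin n) ℂ) =
      A - A.trace • ((n : ℂ)⁻¹ • (1 : Matrix (Fin n) (Fin n) ℂ)) := rfl

lemma lie_eq_glAct (X : sl n) (v : V) : ⁅X, v⁆ = glAct n V X.1 v := by
  rw [glAct, LinearMap.comp_apply, toSl_of_trace X.1 X.2]
  rfl

lemma glAct_one : glAct n V 1 = 0 := by
  have h : toSl n 1 = 0 := by
    refine Subtype.ext ?_
    rw [toSl_coe_eq_sub, Matrix.trace_one, Fintype.card_fin]
    rcases Nat.eq_zero_or_pos n with rfl | hn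
    · exact Subsingleton.elim _ _
    · rw [smul_smul, mul_inv_cancel₀ (by exact_mod_cast hn.ne'), one_smul, sub_self]
      rfl
  rw [glAct, LinearMap.comp_apply, h, map_zero]

lemma glAct_lie (A B : Matrix (Fin n) (Fin n) ℂ) :
    glAct n V ⁅A, B⁆ = ⁅glAct n V A, glAct n V B⁆ := by
  have h : toSl n ⁅A, B⁆ = ⁅toSl n A, toSl n B⁆ := by
    refine Subtype.ext ?_
    rw [LieAlgebra.SpecialLinear.sl_bracket, toSl_coe_eq_sub, toSl_coe_eq_sub, toSl_coe_eq_sub,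
      LieAlgebra.matrix_trace_commutator_zero, zero_smul, sub_zero, Ring.lie_def]
    simp only [sub_mul, mul_sub, smul_mul_assoc, mul_smul_comm, one_mul, mul_one]
    module
  rw [glAct, LinearMap.comp_apply, h]
  exact LieHom.map_lie (LieModule.toEnd ℂ (sl n) V) _ _

/-- The representation of `gl_n` on an `sl_n`-module in which the identity matrix acts as zero. -/
noncomputable def glHom : Matrix (Fin n) (Fin n) ℂ →ₗ⁅ℂ⁆ Module.End ℂ V where
  __ := glAct n V
  map_lie' {A B} := glAct_lie n V A B

variable {n V}

lemma glAct_eq_sum (A : Matrix (Fin n) (Fin n) ℂ) (v : V) :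
    glAct n V A v = ∑ i, ∑ j, A i j • glAct n V (Matrix.single i j 1) v := by
  conv_lhs => rw [Matrix.matrix_eq_sum_single A]
  simp only [map_sum, LinearMap.sum_apply]
  refine Finset.sum_congr rfl fun i _ => Finset.sum_congr rfl fun j _ => ?_
  rw [← LinearMap.smul_apply, ← map_smul, Matrix.smul_single, smul_eq_mul, mul_one]

lemma natCast_smul_glAct_single_self (i : Fin n) (v : V) :
    (n : ℂ) • glAct n V (Matrix.single i i 1) v =
      ∑ j, (glAct n V (Matrix.single i i 1) v - glAct n V (Matrix.single j j 1) v) := by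
  have h : ∑ j, glAct n V (Matrix.single j j 1) v = 0 := by
    have h1 : (1 : Matrix (Fin n) (Fin n) ℂ) = ∑ j, Matrix.single j j 1 := by
      ext a b
      simp [Matrix.sum_apply, Matrix.single_apply, Matrix.one_apply, ite_and, -Finset.sum_boole]
    rw [← LinearMap.sum_apply, ← map_sum, ← h1, glAct_one, LinearMap.zero_apply]
  rw [Finset.sum_sub_distrib, h, sub_zero, Finset.sum_const, Finset.card_univ, Fintype.card_fin,
    Nat.cast_smul_eq_nsmul]

lemma single_lie_single_swap {i j : Fin n} :
    ⁅(Matrix.single i j 1 : Matrix (Fin n) (Fin n) ℂ), (Matrix.single j i 1 : Matrix _ _ ℂ)⁆ =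
      Matrix.single i i 1 - Matrix.single j j 1 := by
  simp [Ring.lie_def]

/-- A subspace of an `sl_n`-module that is stable under the root vectors is a submodule. -/
lemma glAct_mem_of_single_mem {N : Submodule ℂ V}
    (h : ∀ i j, i ≠ j → ∀ v ∈ N, glAct n V (Matrix.single i j 1) v ∈ N)
    (A : Matrix (Fin n) (Fin n) ℂ) : ∀ v ∈ N, glAct n V A v ∈ N := by
  intro v hv
  rw [glAct_eq_sum]
  refine sum_mem fun i _ => sum_mem fun j _ => N.smul_mem _ ?_
  by_cases hij : i = j
  · subst hij
    have hn : (n : ℂ) ≠ 0 := by exact_mod_cast (Fin.pos i).ne'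
    rw [← inv_smul_smul₀ hn (glAct n V (Matrix.single i i 1) v), natCast_smul_glAct_single_self]
    refine N.smul_mem _ (sum_mem fun j _ => ?_)
    by_cases hij : i = j
    · rw [hij, sub_self]; exact zero_mem _
    · rw [← LinearMap.sub_apply, ← map_sub, ← single_lie_single_swap, glAct_lie, Ring.lie_def]
      exact sub_mem (h i j hij _ (h j i (Ne.symm hij) v hv))
        (h j i (Ne.symm hij) _ (h i j hij v hv))
  · exact h i j hij v hv

lemma eq_bot_or_eq_top_of_stable [LieModule.IsIrreducible ℂ (sl n) V] (N : Submodule ℂ V)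
    (h : ∀ A, ∀ v ∈ N, glAct n V A v ∈ N) : N = ⊥ ∨ N = ⊤ := by
  let N' : LieSubmodule ℂ (sl n) V :=
    { N with lie_mem := fun {X v} hv => by rw [lie_eq_glAct]; exact h _ _ hv }
  rcases eq_bot_or_eq_top N' with h | h
  · exact Or.inl (by simpa [N'] using congrArg LieSubmodule.toSubmodule h)
  · exact Or.inr (by simpa [N'] using congrArg LieSubmodule.toSubmodule h)

/-! ### Weight vectors whose weight is the indicator of a set of indices -/

/-- The vector `v` has the weight of `e_S = ⋀_{i ∈ S} e_i`, and is killed by the same root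
vectors. -/
structure IsSubsetWeight (S : Finset (Fin n)) (v : V) : Prop where
  diag : ∀ i j, glAct n V (Matrix.single i i 1) v - glAct n V (Matrix.single j j 1) v =
    ((if i ∈ S then 1 else 0) - (if j ∈ S then 1 else 0) : ℂ) • v
  kill : ∀ i j, i ≠ j → ¬ (i ∉ S ∧ j ∈ S) → glAct n V (Matrix.single i j 1) v = 0

/-- The diagonal matrix with ones at the places in `S`; it grades `gl_n` in degrees `-1, 0, 1`. -/
noncomputable def subsetGrading (S : Finset (Fin n)) : Matrix (Fin n) (Fin n) ℂ :=
  Matrix.diagonal fun i => if i ∈ S then 1 else 0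

lemma subsetGrading_lie_apply (S : Finset (Fin n)) (A : Matrix (Fin n) (Fin n) ℂ) (i j : Fin n) :
    ⁅subsetGrading S, A⁆ i j =
      ((if i ∈ S then 1 else 0) - (if j ∈ S then 1 else 0)) * A i j := by
  simp only [subsetGrading, Ring.lie_def, Matrix.sub_apply, Matrix.diagonal_mul,
    Matrix.mul_diagonal]
  ring

lemma IsSubsetWeight.glAct_of_degree_one {S : Finset (Fin n)} {v : V} (hv : IsSubsetWeight S v)
    {A : Matrix (Fin n) (Fin n) ℂ} (hA : ⁅subsetGrading S, A⁆ = A) : glAct n V A v = 0 := by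
  rw [glAct_eq_sum]
  refine Finset.sum_eq_zero fun i _ => Finset.sum_eq_zero fun j _ => ?_
  have h := congrFun (congrFun hA i) j
  rw [subsetGrading_lie_apply] at h
  by_cases hi : i ∈ S
  · by_cases hij : i = j
    · subst hij
      have : A i i = 0 := by simpa using h.symm
      rw [this, zero_smul]
    · rw [hv.kill i j hij (by tauto), smul_zero]
  · have : A i j = 0 := by
      by_cases hj : j ∈ S
      · simp only [hi, hj, if_true, if_false] at h
        linear_combination (-1 / 2 : ℂ) * h
      · simpa [hi, hj] using h.symm
    rw [this, zero_smul]

lemma IsSubsetWeight.glAct_of_degree_zero {S : Finset (Fin n)} {v : V} (hv : IsSubsetWeight S v)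
    {A : Matrix (Fin n) (Fin n) ℂ} (hA : ⁅subsetGrading S, A⁆ = 0) :
    glAct n V A v = (∑ i, A i i * ((n : ℂ)⁻¹ *
      ∑ j, ((if i ∈ S then 1 else 0) - (if j ∈ S then 1 else 0)))) • v := by
  rw [glAct_eq_sum, Finset.sum_smul]
  refine Finset.sum_congr rfl fun i _ => ?_
  rw [Finset.sum_eq_single i]
  · have hn : (n : ℂ) ≠ 0 := by exact_mod_cast (Fin.pos i).ne'
    rw [mul_smul]
    congr 1
    rw [← inv_smul_smul₀ hn (glAct n V (Matrix.single i i 1) v), natCast_smul_glAct_single_self,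
      mul_smul, Finset.sum_smul]
    congr 1
    exact Finset.sum_congr rfl fun j _ => hv.diag i j
  · intro j _ hij
    have h := congrFun (congrFun hA i) j
    rw [subsetGrading_lie_apply] at h
    by_cases hc : i ∉ S ∧ j ∈ S
    · have : A i j = 0 := by simpa [hc.1, hc.2] using h
      rw [this, zero_smul]
    · rw [hv.kill i j hij.symm hc, smul_zero]
  · simp

lemma exists_subsetGrading_decomposition (S : Finset (Fin n)) (X : Matrix (Fin n) (Fin n) ℂ) :
    ∃ A B C, X = A + B + C ∧ ⁅subsetGrading S, A⁆ = -A ∧ ⁅subsetGrading S, B⁆ = 0 ∧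
      ⁅subsetGrading S, C⁆ = C := by
  refine ⟨Matrix.of fun i j => if i ∉ S ∧ j ∈ S then X i j else 0,
    Matrix.of fun i j => if (i ∈ S ↔ j ∈ S) then X i j else 0,
    Matrix.of fun i j => if i ∈ S ∧ j ∉ S then X i j else 0, ?_, ?_, ?_, ?_⟩ <;>
  · ext i j
    try rw [subsetGrading_lie_apply]
    by_cases hi : i ∈ S <;> by_cases hj : j ∈ S <;> simp [hi, hj]

/-- Irreducible `sl_n`-modules with weight vectors of the same subset weight are isomorphic. -/
theorem nonempty_equiv_of_isSubsetWeight {W : Type*} [AddCommGroup W] [Module ℂ W]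
    [LieRingModule (sl n) W] [LieModule ℂ (sl n) W] [LieModule.IsIrreducible ℂ (sl n) V]
    [LieModule.IsIrreducible ℂ (sl n) W] {S : Finset (Fin n)} {v : V} {w : W} (hv0 : v ≠ 0)
    (hw0 : w ≠ 0) (hv : IsSubsetWeight S v) (hw : IsSubsetWeight S w) :
    Nonempty (V ≃ₗ⁅ℂ, sl n⁆ W) := by
  obtain ⟨φ, hφ⟩ := exists_equiv_of_common_highest (glHom n V) (glHom n W)
    eq_bot_or_eq_top_of_stable eq_bot_or_eq_top_of_stable (subsetGrading S)
    (exists_subsetGrading_decomposition S) hv0 hw0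
    (fun X hX => ⟨hv.glAct_of_degree_one hX, hw.glAct_of_degree_one hX⟩)
    (fun X hX => ⟨_, hv.glAct_of_degree_zero hX, hw.glAct_of_degree_zero hX⟩)
  exact ⟨{ φ with
    map_lie' := fun {X y} => by
      change φ ⁅X, y⁆ = ⁅X, φ y⁆
      rw [lie_eq_glAct, lie_eq_glAct]
      exact hφ X.1 y
    invFun := φ.symm
    left_inv := φ.left_inv
    right_inv := φ.right_inv }⟩

end GeneralLinear

/-! ### Modules on which the root vectors square to zero -/

section SquareZero

/-- Relations in an `sl₂`-triple `(e, h, f)` of operators with `e² = f² = 0`. -/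
lemma sl2_relations {R : Type*} [Ring R] [Algebra ℂ R] {e f h : R} (hef : e * f - f * e = h)
    (hhe : h * e - e * h = 2 * e) (hhf : h * f - f * h = -(2 * f)) (he : e * e = 0)
    (hf : f * f = 0) : e * h = -e ∧ h * h * h = h := by
  have two : ∀ {x y : R}, 2 * x = 2 * y → x = y := fun {x y} hxy => by
    have h2 : (2 : ℂ) • x = (2 : ℂ) • y := by simpa [two_smul, two_mul] using hxy
    exact smul_right_injective R (two_ne_zero (α := ℂ)) h2
  have h1 : e * h = -(e * f * e) := by rw [← hef, mul_sub, ← mul_assoc, he]; noncomm_ring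
  have h2 : h * e = e * f * e := by
    rw [← hef, sub_mul, mul_assoc f e e, he]; noncomm_ring
  have h3 : f * h = f * e * f := by
    rw [← hef, mul_sub, ← mul_assoc f f e, hf]; noncomm_ring
  have h4 : h * f = -(f * e * f) := by rw [← hef, sub_mul, mul_assoc e f f, hf]; noncomm_ring
  have h5 : e * f * e = e := two (by rw [← hhe, h1, h2]; noncomm_ring)
  have h6 : f * e * f = f := two (by
    rw [← neg_inj, ← hhf, h3, h4]; noncomm_ring)
  rw [h5] at h1 h2
  rw [h6] at h3 h4
  have h7 : h * h = e * f + f * e := by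
    nth_rewrite 2 [← hef]
    rw [mul_sub, ← mul_assoc, ← mul_assoc, h2, h4]; noncomm_ring
  refine ⟨h1, ?_⟩
  rw [mul_assoc, h7, mul_add, ← mul_assoc, ← mul_assoc, h2, h4, ← hef]; noncomm_ring

/-- Commuting operators with `T³ = T` have a common eigenvector. -/
lemma exists_common_eigenvector {ι V : Type*} [AddCommGroup V] [Module ℂ V] [Nontrivial V]
    (T : ι → Module.End ℂ V) (hT : ∀ i, T i * T i * T i = T i)
    (hcomm : ∀ i j, T i * T j = T j * T i) (J : Finset ι) :
    ∃ v : V, v ≠ 0 ∧ ∀ j ∈ J, ∃ c : ℂ, T j v = c • v := by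
  classical
  induction J using Finset.induction_on with
  | empty => obtain ⟨v, hv⟩ := exists_ne (0 : V); exact ⟨v, hv, by simp⟩
  | insert j J _ ih =>
    obtain ⟨v, hv, hJ⟩ := ih
    have h3 : T j (T j (T j v)) = T j v := LinearMap.congr_fun (hT j) v
    -- Each of the three factors of `T(T - 1)(T + 1)` is tried as the one that is left out.
    have key : ∀ (a b c : ℂ), (b • v + c • T j v + T j (T j v) ≠ 0) →
        T j (b • v + c • T j v + T j (T j v)) = a • (b • v + c • T j v + T j (T j v)) →
        ∃ v : V, v ≠ 0 ∧ ∀ i, i = j ∨ i ∈ J → ∃ c : ℂ, T i v = c • v := by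
      intro a b c hne ha
      refine ⟨_, hne, fun i hi => ?_⟩
      rcases hi with hi | hi
      · exact ⟨a, hi ▸ ha⟩
      · obtain ⟨d, hd⟩ := hJ i hi
        have hc : ∀ w, T i (T j w) = T j (T i w) := LinearMap.congr_fun (hcomm i j)
        refine ⟨d, ?_⟩
        simp only [map_add, map_smul, hc, hd]
        module
    simp only [Finset.mem_insert]
    by_cases h0 : (-1 : ℂ) • v + (0 : ℂ) • T j v + T j (T j v) = 0
    · by_cases h1 : (0 : ℂ) • v + (1 : ℂ) • T j v + T j (T j v) = 0
      · refine key (-1) 0 (-1) (fun h2 => hv ?_) ?_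
        · have : v = (1 / 2 : ℂ) • ((0 : ℂ) • v + (1 : ℂ) • T j v + T j (T j v)) +
            (1 / 2 : ℂ) • ((0 : ℂ) • v + (-1 : ℂ) • T j v + T j (T j v)) -
            ((-1 : ℂ) • v + (0 : ℂ) • T j v + T j (T j v)) := by module
          rw [this, h0, h1, h2]; simp
        · simp only [map_add, map_smul, h3]; module
      · refine key 1 0 1 h1 ?_
        simp only [map_add, map_smul, h3]; module
    · refine key 0 (-1) 0 h0 ?_
      simp only [map_add, map_smul, h3]; module

variable {n : ℕ} {V : Type*} [AddCommGroup V] [Module ℂ V] [LieRingModule (sl n) V]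
  [LieModule ℂ (sl n) V]

lemma glAct_sl2_relations (hsq : ∀ i j : Fin n, i ≠ j →
      glAct n V (Matrix.single i j 1) * glAct n V (Matrix.single i j 1) = 0)
    {i j : Fin n} (hij : i ≠ j) :
    let h := glAct n V (Matrix.single i i 1) - glAct n V (Matrix.single j j 1)
    glAct n V (Matrix.single i j 1) * h = -glAct n V (Matrix.single i j 1) ∧ h * h * h = h := by
  intro h
  refine sl2_relations (f := glAct n V (Matrix.single j i 1)) ?_ ?_ ?_ (hsq i j hij)
    (hsq j i hij.symm)
  · rw [← Ring.lie_def, ← glAct_lie, single_lie_single_swap, map_sub]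
  · rw [← Ring.lie_def, show h = _ from (map_sub _ _ _).symm, ← glAct_lie, Ring.lie_def, two_mul, ← map_add]
    congr 1
    simp [sub_mul, mul_sub, hij.symm]
  · rw [← Ring.lie_def, show h = _ from (map_sub _ _ _).symm, ← glAct_lie, Ring.lie_def, two_mul, ← map_add, ← map_neg]
    congr 1
    simp [sub_mul, mul_sub, hij]
    abel

/-- If the root vectors square to zero on `V`, the weights of `V` are those of exterior powers. -/
theorem exists_isSubsetWeight [Nontrivial V] (hn : 0 < n)
    (hsq : ∀ i j : Fin n, i ≠ j →
      glAct n V (Matrix.single i j 1) * glAct n V (Matrix.single i j 1) = 0) :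
    ∃ (S : Finset (Fin n)) (v : V), S.card < n ∧ v ≠ 0 ∧ IsSubsetWeight S v := by
  classical
  set o : Fin n := ⟨0, hn⟩
  have hcube : ∀ i j : Fin n,
      (glAct n V (Matrix.single i i 1) - glAct n V (Matrix.single j j 1)) *
      (glAct n V (Matrix.single i i 1) - glAct n V (Matrix.single j j 1)) *
      (glAct n V (Matrix.single i i 1) - glAct n V (Matrix.single j j 1)) =
      glAct n V (Matrix.single i i 1) - glAct n V (Matrix.single j j 1) := by
    intro i j
    by_cases hij : i = j
    · subst hij; simp
    · exact (glAct_sl2_relations hsq hij).2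
  have hdc : ∀ i j : Fin n, glAct n V (Matrix.single i i 1) * glAct n V (Matrix.single j j 1) =
      glAct n V (Matrix.single j j 1) * glAct n V (Matrix.single i i 1) := by
    intro i j
    rw [← sub_eq_zero, ← Ring.lie_def, ← glAct_lie, Ring.lie_def]
    by_cases hij : i = j
    · subst hij; simp
    · simp [hij, Ne.symm hij]
  obtain ⟨v, hv, hev⟩ := exists_common_eigenvector
    (fun j : Fin n => glAct n V (Matrix.single o o 1) - glAct n V (Matrix.single j j 1))
    (hcube o) (fun i j => by
      simp only [sub_mul, mul_sub]
      rw [hdc o i, hdc j o, hdc j i]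
      abel) Finset.univ
  choose! c hc using fun j => hev j (Finset.mem_univ j)
  have hdiag : ∀ i j, (glAct n V (Matrix.single i i 1) - glAct n V (Matrix.single j j 1)) v =
      (c j - c i) • v := by
    intro i j
    rw [sub_smul, ← hc j, ← hc i]
    simp only [LinearMap.sub_apply]
    abel
  have hval : ∀ i j, c j - c i = 0 ∨ c j - c i = 1 ∨ c j - c i = -1 := by
    intro i j
    have h := LinearMap.congr_fun (hcube i j) v
    simp only [Module.End.mul_apply, hdiag, map_smul, smul_smul] at h
    have h' : (c j - c i) * (c j - c i) * (c j - c i) = c j - c i := by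
      rw [mul_assoc]; exact smul_left_injective ℂ hv h
    have : (c j - c i) * ((c j - c i - 1) * (c j - c i + 1)) = 0 := by linear_combination h'
    rcases mul_eq_zero.1 this with h | h
    · exact Or.inl h
    · rcases mul_eq_zero.1 h with h | h
      · exact Or.inr (Or.inl (sub_eq_zero.1 h))
      · exact Or.inr (Or.inr (eq_neg_of_add_eq_zero_left h))
  have hco : c o = 0 := by
    have h := hc o
    simp only [sub_self, LinearMap.zero_apply] at h
    exact (smul_eq_zero.1 h.symm).resolve_right hv
  -- Up to a common shift, the numbers `-c i` are the indicator function of a proper subset.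
  obtain ⟨S, hS, hSc⟩ : ∃ S : Finset (Fin n), S.card < n ∧ ∀ i j,
      c j - c i = (if i ∈ S then 1 else 0) - (if j ∈ S then 1 else 0) := by
    have hlt : ∀ (S : Finset (Fin n)) (i : Fin n), i ∉ S → S.card < n := fun S i hi => by
      simpa using Finset.card_lt_univ_of_notMem hi
    have hval' : ∀ i, c i = 0 ∨ c i = 1 ∨ c i = -1 := fun i => by simpa [hco] using hval o i
    by_cases hex : ∃ i, c i = 1
    · obtain ⟨i₀, hi₀⟩ := hex
      refine ⟨Finset.univ.filter fun i => c i = 0, hlt _ i₀ (by simp [hi₀]), fun i j => ?_⟩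
      have h01 : ∀ i, c i = 0 ∨ c i = 1 := fun i => by
        rcases hval' i with h | h | h
        · exact Or.inl h
        · exact Or.inr h
        · have := hval i i₀
          rw [h, hi₀] at this
          norm_num at this
      rcases h01 i with hi | hi <;> rcases h01 j with hj | hj <;> simp [hi, hj]
    · push Not at hex
      refine ⟨Finset.univ.filter fun i => c i = -1, hlt _ o (by simp [hco]), fun i j => ?_⟩
      have h01 : ∀ i, c i = 0 ∨ c i = -1 := fun i => by
        rcases hval' i with h | h | h
        · exact Or.inl h
        · exact absurd h (hex i)
        · exact Or.inr h
      rcases h01 i with hi | hi <;> rcases h01 j with hj | hj <;> simp [hi, hj]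
  refine ⟨S, v, hS, hv, fun i j => ?_, fun i j hij hnot => ?_⟩
  · rw [← LinearMap.sub_apply, hdiag, hSc]
  · have h := LinearMap.congr_fun (glAct_sl2_relations hsq hij).1 v
    rw [Module.End.mul_apply, hdiag, hSc, map_smul, LinearMap.neg_apply] at h
    by_cases hi : i ∈ S
    · by_cases hj : j ∈ S
      · simpa [hi, hj] using h
      · simp only [hi, hj, if_true, if_false, sub_zero, one_smul] at h
        have h2 : (2 : ℂ) • glAct n V (Matrix.single i j 1) v = 0 := by
          rw [two_smul]; nth_rewrite 1 [h]; exact neg_add_cancel _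
        exact (smul_eq_zero.1 h2).resolve_left two_ne_zero
    · have hj : j ∉ S := by tauto
      simpa [hi, hj] using h

end SquareZero

/-! ### Irreducibility of the exterior powers -/

section Exterior

variable {n k : ℕ}

/-- The vector `e_{a 0} ∧ ⋯ ∧ e_{a (k-1)}` of the `k`-th exterior power. -/
noncomputable def wedge (a : Fin k → Fin n) : Fund n k :=
  exteriorPower.ιMulti ℂ k fun p => (Pi.single (a p) 1 : Fin n → ℂ)

lemma wedge_eq_zero {a : Fin k → Fin n} {p q : Fin k} (h : a p = a q) (hpq : p ≠ q) :
    wedge a = 0 :=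
  (exteriorPower.ιMulti ℂ k).map_eq_zero_of_eq _ (by rw [h]) hpq

lemma wedge_perm (a : Fin k → Fin n) (σ : Equiv.Perm (Fin k)) :
    wedge (a ∘ σ) = Equiv.Perm.sign σ • wedge a :=
  (exteriorPower.ιMulti ℂ k).map_perm (fun p => (Pi.single (a p) 1 : Fin n → ℂ)) σ

/-- The action of the matrix unit `E_ij` on the `k`-th exterior power, also for `i = j`. -/
noncomputable def unitAct (i j : Fin n) : Module.End ℂ (Fund n k) :=
  extAct k (Matrix.toLin' (Matrix.single i j 1))

lemma unitAct_wedge (i j : Fin n) (a : Fin k → Fin n) :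
    unitAct i j (wedge a) =
      ∑ p, if a p = j then wedge (Function.update a p i) else 0 := by
  refine (extAct_ιMulti _ _).trans (Finset.sum_congr rfl fun p _ => ?_)
  have h : Matrix.toLin' (Matrix.single i j (1 : ℂ)) (Pi.single (a p) 1) =
      if a p = j then Pi.single i 1 else 0 := by
    rw [Matrix.toLin'_apply, Matrix.single_mulVec]
    split_ifs with h
    · ext x; simp [h, Function.update_apply, Pi.single_apply]
    · ext x; simp [Function.update_apply, Ne.symm h]
  rw [h]
  split_ifs with h
  · refine congrArg (exteriorPower.ιMulti ℂ k) (funext fun q => ?_)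
    by_cases hq : q = p
    · subst hq; simp
    · simp [hq]
  · exact (exteriorPower.ιMulti ℂ k).map_update_zero _ _

lemma glAct_single_eq_unitAct {i j : Fin n} (hij : i ≠ j) (w : Fund n k) :
    glAct n (Fund n k) (Matrix.single i j 1) w =
      unitAct i j w := by
  rw [glAct, LinearMap.comp_apply,
    toSl_of_trace _ (Matrix.trace_single_eq_of_ne i j (1 : ℂ) hij)]
  rfl

lemma glAct_diag_eq_unitAct (i j : Fin n) (w : Fund n k) :
    glAct n (Fund n k) (Matrix.single i i 1) w - glAct n (Fund n k) (Matrix.single j j 1) w =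
      unitAct i i w - unitAct j j w := by
  have htr : (Matrix.single i i 1 - Matrix.single j j 1 : Matrix (Fin n) (Fin n) ℂ) ∈ sl n := by
    change Matrix.trace (Matrix.single i i 1 - Matrix.single j j 1 : Matrix (Fin n) (Fin n) ℂ) = 0
    simp
  rw [← LinearMap.sub_apply, ← map_sub, glAct, LinearMap.comp_apply, toSl_of_trace _ htr]
  have h := LinearMap.congr_fun (extAct_add (k := k) (Matrix.toLin' (Matrix.single i i (1 : ℂ) -
    Matrix.single j j 1)) (Matrix.toLin' (Matrix.single j j (1 : ℂ)))) w
  rw [← map_add, sub_add_cancel] at h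
  exact (sub_eq_of_eq_add h).symm

lemma glAct_single_wedge_of_notMem {i j : Fin n} (hij : i ≠ j) {a : Fin k → Fin n}
    (hj : ∀ p, a p ≠ j) : glAct n (Fund n k) (Matrix.single i j 1) (wedge a) = 0 := by
  rw [glAct_single_eq_unitAct hij, unitAct_wedge]
  simp [hj]

lemma glAct_single_wedge {i : Fin n} {a : Fin k → Fin n} (ha : Function.Injective a) (p : Fin k)
    (hi : i ≠ a p) : glAct n (Fund n k) (Matrix.single i (a p) 1) (wedge a) =
      wedge (Function.update a p i) := by
  rw [glAct_single_eq_unitAct hi, unitAct_wedge]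
  simp [ha.eq_iff]

lemma isSubsetWeight_wedge {a : Fin k → Fin n} (ha : Function.Injective a) :
    IsSubsetWeight (Finset.univ.image a) (wedge a) where
  diag i j := by
    have h : ∀ i, unitAct i i (wedge a) = (if i ∈ Finset.univ.image a then 1 else 0 : ℂ) • wedge a := by
      intro i
      rw [unitAct_wedge]
      by_cases hi : ∃ p, a p = i
      · obtain ⟨p, rfl⟩ := hi
        simp [ha.eq_iff]
      · have hi' : ∀ p, a p ≠ i := fun p hp => hi ⟨p, hp⟩
        simp [hi']
    rw [glAct_diag_eq_unitAct, h, h, sub_smul]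
  kill i j hij hnot := by
    by_cases hj : ∃ q, a q = j
    · obtain ⟨q, rfl⟩ := hj
      rw [glAct_single_wedge ha q hij]
      have hi : ∃ p, a p = i := by
        by_contra h
        exact hnot ⟨by simpa using h, by simp⟩
      obtain ⟨p, rfl⟩ := hi
      have hpq : p ≠ q := fun h => hij (by rw [h])
      exact wedge_eq_zero (p := p) (q := q) (by simp [hpq]) hpq
    · exact glAct_single_wedge_of_notMem hij fun p hp => hj ⟨p, hp⟩

/-- The operators `E_ij E_ji` are the projections onto the span of the weight vectors that involve
`e_i` but not `e_j`. -/
lemma glAct_single_mul_single_wedge {i j : Fin n} (hij : i ≠ j) {a : Fin k → Fin n}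
    (ha : Function.Injective a) :
    glAct n (Fund n k) (Matrix.single i j 1)
      (glAct n (Fund n k) (Matrix.single j i 1) (wedge a)) =
      if i ∈ Finset.univ.image a ∧ j ∉ Finset.univ.image a then wedge a else 0 := by
  split_ifs with h
  · obtain ⟨p, -, rfl⟩ := Finset.mem_image.1 h.1
    have hj : ∀ q, a q ≠ j := fun q hq => h.2 (by simp [← hq])
    have hinj : Function.Injective (Function.update a p j) := by
      intro q r hqr
      by_cases hq : q = p <;> by_cases hr : r = p <;> simp_all [ha.eq_iff]
    rw [glAct_single_wedge ha p hij.symm]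
    have h' := glAct_single_wedge (k := k) (i := a p) hinj p (by simpa using hij)
    rw [Function.update_self] at h'
    rw [h', Function.update_idem, Function.update_eq_self]
  · rw [(isSubsetWeight_wedge ha).kill j i hij.symm (by tauto), map_zero]

/-- The basis of the `k`-th exterior power formed by the wedges of increasing families. -/
noncomputable def wedgeBasis (n k : ℕ) : Module.Basis (Set.powersetCard (Fin n) k) ℂ (Fund n k) :=
  (Pi.basisFun ℂ (Fin n)).exteriorPower k

lemma wedgeBasis_apply (T : Set.powersetCard (Fin n) k) :
    wedgeBasis n k T = wedge (Set.powersetCard.ofFinEmbEquiv.symm T) := by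
  refine (exteriorPower.basis_apply ℂ k (Pi.basisFun ℂ (Fin n)) T).trans ?_
  refine congrArg (exteriorPower.ιMulti ℂ k) (funext fun p => ?_)
  simp

lemma image_ofFinEmbEquiv_symm (T : Set.powersetCard (Fin n) k) :
    Finset.univ.image (Set.powersetCard.ofFinEmbEquiv.symm T) = T.1 := by
  ext i
  have := Set.powersetCard.mem_range_ofFinEmbEquiv_symm_iff_mem T i
  simpa using! this

/-- A submodule containing one wedge of distinct basis vectors contains all of them. -/
lemma wedgeBasis_mem_of_wedge_mem {N : Submodule ℂ (Fund n k)}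
    (hN : ∀ A, ∀ v ∈ N, glAct n (Fund n k) A v ∈ N) (T : Set.powersetCard (Fin n) k) :
    ∀ (m : ℕ) (a : Fin k → Fin n), Function.Injective a → wedge a ∈ N →
      (T.1 \ Finset.univ.image a).card = m → wedgeBasis n k T ∈ N := by
  intro m
  induction m with
  | zero =>
    intro a ha haN hm
    have hsub : T.1 ⊆ Finset.univ.image a := by
      rwa [Finset.card_eq_zero, Finset.sdiff_eq_empty_iff_subset] at hm
    have hcard : (Finset.univ.image a).card = k := by
      rw [Finset.card_image_of_injective _ ha, Finset.card_univ, Fintype.card_fin]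
    have hTa : T.1 = Finset.univ.image a :=
      Finset.eq_of_subset_of_card_le hsub (by rw [hcard, Set.powersetCard.card_eq T])
    set b := Set.powersetCard.ofFinEmbEquiv.symm T with hb
    have hr : Set.range b = Set.range a := by
      have := (image_ofFinEmbEquiv_symm T).trans hTa
      simpa [← Finset.coe_inj] using this
    let σ : Equiv.Perm (Fin k) := (Equiv.ofInjective b b.injective).trans
      ((Equiv.setCongr hr).trans (Equiv.ofInjective a ha).symm)
    have hσ : (b : Fin k → Fin n) = a ∘ σ := by
      funext p
      simp [σ, Equiv.apply_ofInjective_symm]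
    rw [wedgeBasis_apply, ← hb, hσ, wedge_perm, Units.smul_def]
    exact zsmul_mem haN _
  | succ m ih =>
    intro a ha haN hm
    obtain ⟨i, hi⟩ := Finset.card_pos.1 (hm ▸ Nat.succ_pos m : 0 < (T.1 \ Finset.univ.image a).card)
    rw [Finset.mem_sdiff] at hi
    have hcard : (Finset.univ.image a).card = k := by
      rw [Finset.card_image_of_injective _ ha, Finset.card_univ, Fintype.card_fin]
    obtain ⟨p, hp⟩ : ∃ p, a p ∉ T.1 := by
      by_contra h
      push Not at h
      have hsub : Finset.univ.image a ⊆ T.1 := by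
        intro x hx
        obtain ⟨p, -, rfl⟩ := Finset.mem_image.1 hx
        exact h p
      exact hi.2 ((Finset.eq_of_subset_of_card_le hsub (by rw [hcard, Set.powersetCard.card_eq T])) ▸ hi.1)
    have hai : ∀ q, a q ≠ i := fun q hq => hi.2 (by simp [← hq])
    have hinj : Function.Injective (Function.update a p i) := by
      intro q r hqr
      by_cases hq : q = p <;> by_cases hr : r = p <;> simp_all [ha.eq_iff]
    refine ih (Function.update a p i) hinj ?_ ?_
    · rw [← glAct_single_wedge ha p (hai p).symm]
      exact hN _ _ haN
    · have : T.1 \ Finset.univ.image (Function.update a p i) =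
          (T.1 \ Finset.univ.image a).erase i := by
        ext x
        simp only [Finset.mem_sdiff, Finset.mem_image, Finset.mem_univ, true_and,
          Finset.mem_erase, not_exists]
        constructor
        · rintro ⟨hx, h⟩
          refine ⟨fun hxi => h p (by simp [hxi]), hx, fun q hq => ?_⟩
          by_cases hqp : q = p
          · subst hqp; exact hp (hq ▸ hx)
          · exact h q (by simpa [hqp] using hq)
        · rintro ⟨hxi, hx, h⟩
          refine ⟨hx, fun q hq => ?_⟩
          by_cases hqp : q = p
          · subst hqp; exact hxi (by simpa using hq.symm)
          · exact h q (by simpa [hqp] using hq)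
      rw [this, Finset.card_erase_of_mem (by rw [Finset.mem_sdiff]; exact hi), hm]
      rfl

/-- The exterior powers of the natural module are irreducible: a vector of minimal support in a
submodule is a multiple of a basis vector. -/
theorem isIrreducible_fund (hk : k ≤ n) : LieModule.IsIrreducible ℂ (sl n) (Fund n k) := by
  classical
  have hne : Nonempty (Set.powersetCard (Fin n) k) := by
    obtain ⟨T, -, hT⟩ := Finset.exists_subset_card_eq (s := (Finset.univ : Finset (Fin n)))
      (n := k) (by simpa using hk)
    exact ⟨⟨T, hT⟩⟩
  have : Nontrivial (Fund n k) := (wedgeBasis n k).repr.toEquiv.nontrivial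
  refine LieModule.IsIrreducible.mk fun N hN => ?_
  have hst : ∀ A, ∀ v ∈ N.toSubmodule, glAct n (Fund n k) A v ∈ N.toSubmodule := fun A v hv =>
    N.lie_mem (x := toSl n A) hv
  obtain ⟨w₀, hw₀, hw₀0⟩ := (Submodule.ne_bot_iff N.toSubmodule).1 (by simpa using hN)
  obtain ⟨w, ⟨hwN, hw0⟩, hmin⟩ := WellFounded.has_min
    (measure fun w : Fund n k => ((wedgeBasis n k).repr w).support.card).wf
    {w | w ∈ N ∧ w ≠ 0} ⟨w₀, hw₀, hw₀0⟩
  have hproj : ∀ i j, i ≠ j → ∀ (x : Fund n k) (T : Set.powersetCard (Fin n) k),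
      (wedgeBasis n k).repr (glAct n (Fund n k) (Matrix.single i j 1)
        (glAct n (Fund n k) (Matrix.single j i 1) x)) T =
      if i ∈ T.1 ∧ j ∉ T.1 then (wedgeBasis n k).repr x T else 0 := by
    intro i j hij x T
    induction (wedgeBasis n k).mem_span x using Submodule.span_induction with
    | zero => simp
    | add x y _ _ hx hy => simp only [map_add, Finsupp.add_apply, hx, hy]; split_ifs <;> simp
    | smul c x _ hx => simp only [map_smul, Finsupp.smul_apply, hx]; split_ifs <;> simp
    | mem x hx =>
      obtain ⟨U, rfl⟩ := hx
      rw [wedgeBasis_apply, glAct_single_mul_single_wedge hij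
        (Set.powersetCard.ofFinEmbEquiv.symm U).injective, image_ofFinEmbEquiv_symm]
      by_cases hUT : U = T
      · subst hUT; split_ifs <;> simp
      · have : (wedgeBasis n k).repr (wedgeBasis n k U) T = 0 := by
          rw [Module.Basis.repr_self, Finsupp.single_eq_of_ne (Ne.symm hUT)]
        rw [wedgeBasis_apply] at this
        split_ifs <;> simp [this]
  obtain ⟨T, hT⟩ : ∃ T, (wedgeBasis n k).repr w T ≠ 0 := by
    by_contra h
    push Not at h
    exact hw0 ((wedgeBasis n k).repr.map_eq_zero_iff.1 (Finsupp.ext h))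
  have huniq : ∀ U, (wedgeBasis n k).repr w U ≠ 0 → U = T := by
    intro U hU
    by_contra hne
    obtain ⟨i, hiT, hiU⟩ := (Set.powersetCard.exists_mem_notMem_iff_ne T U).1 (Ne.symm hne)
    obtain ⟨j, hjU, hjT⟩ := (Set.powersetCard.exists_mem_notMem_iff_ne U T).1 hne
    have hij : i ≠ j := fun h => hjT (h ▸ hiT)
    have hr := hproj i j hij w
    refine hmin _ ⟨hst (Matrix.single i j 1) _ (hst (Matrix.single j i 1) _ hwN), fun h0 => ?_⟩
      (Finset.card_lt_card ⟨fun R hR => ?_, fun hsub => ?_⟩)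
    · have := hr T
      rw [h0, if_pos ⟨hiT, hjT⟩] at this
      exact hT (by simpa using this.symm)
    · rw [Finsupp.mem_support_iff, hr] at hR
      rw [Finsupp.mem_support_iff]
      intro h0
      simp [h0] at hR
    · have := hsub (Finsupp.mem_support_iff.2 hU)
      rw [Finsupp.mem_support_iff, hr, if_neg fun h => h.2 hjU] at this
      exact this rfl
  have hw : w = (wedgeBasis n k).repr w T • wedgeBasis n k T := by
    conv_lhs => rw [← (wedgeBasis n k).sum_repr w]
    refine Finset.sum_eq_single T (fun U _ hU => ?_) (by simp)
    rw [not_not.1 fun h => hU (huniq U h), zero_smul]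
  have hTN : wedgeBasis n k T ∈ N.toSubmodule := by
    rw [← inv_smul_smul₀ hT (wedgeBasis n k T), ← hw]
    exact N.toSubmodule.smul_mem _ hwN
  rw [wedgeBasis_apply] at hTN
  rw [← LieSubmodule.toSubmodule_eq_top, eq_top_iff, ← (wedgeBasis n k).span_eq,
    Submodule.span_le]
  rintro _ ⟨U, rfl⟩
  exact wedgeBasis_mem_of_wedge_mem hst U _ _
    (Set.powersetCard.ofFinEmbEquiv.symm T).injective hTN rfl

/-- An irreducible `sl_n`-module on which all root vectors square to zero is an exterior power of
the natural module. -/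
theorem exists_equiv_fund {V : Type*} [AddCommGroup V] [Module ℂ V] [LieRingModule (sl n) V]
    [LieModule ℂ (sl n) V] [LieModule.IsIrreducible ℂ (sl n) V] (hn : 0 < n)
    (hsq : ∀ i j : Fin n, i ≠ j →
      glAct n V (Matrix.single i j 1) * glAct n V (Matrix.single i j 1) = 0) :
    ∃ k < n, Nonempty (V ≃ₗ⁅ℂ, sl n⁆ Fund n k) := by
  have : Nontrivial V := LieModule.nontrivial_of_isIrreducible ℂ (sl n) V
  obtain ⟨S, v, hS, hv0, hv⟩ := exists_isSubsetWeight hn hsq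
  refine ⟨S.card, hS, ?_⟩
  have : LieModule.IsIrreducible ℂ (sl n) (Fund n S.card) := isIrreducible_fund hS.le
  let T : Set.powersetCard (Fin n) S.card := ⟨S, rfl⟩
  have hw := isSubsetWeight_wedge (Set.powersetCard.ofFinEmbEquiv.symm T).injective
  rw [image_ofFinEmbEquiv_symm T] at hw
  refine nonempty_equiv_of_isSubsetWeight hv0 ?_ hv hw
  rw [← wedgeBasis_apply]
  exact (wedgeBasis n S.card).ne_zero T

end Exterior

/-! ### Schur's lemma in countable dimension -/

section Schur

open Polynomial Cardinal

/-- A division algebra over `ℂ` of countable dimension is `ℂ`: a transcendental element `f` would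
give the uncountable linearly independent family of the `(f - c)⁻¹`. -/
theorem algebraMap_surjective_of_rank_le_aleph0 {D : Type*} [DivisionRing D] [Algebra ℂ D]
    (hD : Module.rank ℂ D ≤ ℵ₀) : Function.Surjective (algebraMap ℂ D) := by
  classical
  have : Algebra.IsIntegral ℂ D := by
    refine ⟨fun f => ?_⟩
    rw [← isAlgebraic_iff_isIntegral]
    by_contra hf
    have hinj : ∀ p : ℂ[X], aeval f p = 0 → p = 0 := fun p hp => by
      by_contra h0
      exact hf ⟨p, h0, hp⟩
    have hne : ∀ c : ℂ, f - algebraMap ℂ D c ≠ 0 := fun c hc => by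
      refine X_sub_C_ne_zero c (hinj _ ?_)
      simpa using hc
    have hli : LinearIndependent ℂ fun c : ℂ => (f - algebraMap ℂ D c)⁻¹ := by
      rw [linearIndependent_iff']
      intro s g hg c hc
      have hp : ∑ i ∈ s, g i • ∏ j ∈ s.erase i, (X - C j) = 0 := by
        refine hinj _ ?_
        have hi : ∀ i ∈ s, aeval f (g i • ∏ j ∈ s.erase i, (X - C j)) =
            aeval f (∏ j ∈ s, (X - C j)) * (g i • (f - algebraMap ℂ D i)⁻¹) := by
          intro i hi
          rw [← Finset.prod_erase_mul s _ hi, map_mul, map_smul, map_sub, aeval_X, aeval_C,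
            mul_smul_comm, mul_assoc, mul_inv_cancel₀ (hne i), mul_one]
        rw [map_sum, Finset.sum_congr rfl hi, ← Finset.mul_sum, hg, mul_zero]
      have hev := congrArg (eval c) hp
      rw [eval_finsetSum, Finset.sum_eq_single c, eval_smul, eval_prod, eval_zero,
        smul_eq_mul] at hev
      · refine (mul_eq_zero.1 hev).resolve_right (Finset.prod_ne_zero_iff.2 fun j hj => ?_)
        simpa [sub_eq_zero] using (Finset.ne_of_mem_erase hj).symm
      · intro i _ hic
        rw [eval_smul, eval_prod, Finset.prod_eq_zero (Finset.mem_erase.2 ⟨hic.symm, hc⟩)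
          (by simp), smul_zero]
      · exact fun h => absurd hc h
    have h1 := hli.cardinal_lift_le_rank
    rw [Cardinal.mk_complex, Cardinal.lift_continuum] at h1
    exact (h1.trans (Cardinal.lift_le_aleph0.2 hD)).not_gt Cardinal.aleph0_lt_continuum
  exact IsAlgClosed.algebraMap_bijective_of_isIntegral.2

/-- Schur's lemma for simple modules over an algebra of countable dimension over `ℂ`. -/
theorem exists_eq_smul_of_rank_le_aleph0 {A P : Type*} [Ring A] [Algebra ℂ A] [AddCommGroup P]
    [Module ℂ P] [Module A P] [IsScalarTower ℂ A P] [IsSimpleModule A P]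
    (hA : Module.rank ℂ A ≤ ℵ₀) (f : Module.End A P) : ∃ c : ℂ, ∀ z, f z = c • z := by
  classical
  have : SMulCommClass A ℂ P := IsScalarTower.to_smulCommClass'
  have : Nontrivial P := IsSimpleModule.nontrivial A P
  obtain ⟨z₀, hz₀⟩ := exists_ne (0 : P)
  have hP : Module.rank ℂ P ≤ ℵ₀ := by
    have h := LinearMap.lift_rank_le_of_surjective
      ((LinearMap.toSpanSingleton A P z₀).restrictScalars ℂ)
      (IsSimpleModule.toSpanSingleton_surjective A hz₀)
    exact Cardinal.lift_le_aleph0.1 (h.trans (Cardinal.lift_le_aleph0.2 hA))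
  let ev : Module.End A P →ₗ[ℂ] P :=
    { toFun := fun g => g z₀, map_add' := fun _ _ => rfl, map_smul' := fun _ _ => rfl }
  have hev : Function.Injective ev := by
    rw [injective_iff_map_eq_zero]
    intro g hg
    refine (LinearMap.bijective_or_eq_zero g).resolve_left fun hb => hz₀ ?_
    exact hb.1 (hg.trans (map_zero g).symm)
  have hD : Module.rank ℂ (Module.End A P) ≤ ℵ₀ := (LinearMap.rank_le_of_injective ev hev).trans hP
  obtain ⟨c, hc⟩ := algebraMap_surjective_of_rank_le_aleph0 (D := Module.End A P) hD f
  exact ⟨c, fun z => by rw [← hc]; rfl⟩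

/-- Over an algebra of countable dimension, every operator of rank one on a simple module agrees on
any given finite set with the action of an element of the algebra. -/
theorem exists_smul_eq_of_rank_le_aleph0 {A P : Type*} [Ring A] [Algebra ℂ A] [AddCommGroup P]
    [Module ℂ P] [Module A P] [IsScalarTower ℂ A P] [IsSimpleModule A P]
    (hA : Module.rank ℂ A ≤ ℵ₀) (T : Module.End ℂ P) (s : Finset P) :
    ∃ a : A, ∀ z ∈ s, a • z = T z := by
  let T' : Module.End (Module.End A P) P :=
    { toFun := T
      map_add' := map_add T
      map_smul' := fun f z => by
        obtain ⟨c, hc⟩ := exists_eq_smul_of_rank_le_aleph0 hA f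
        simp only [Module.End.smul_def, hc, map_smul, RingHom.id_apply] }
  obtain ⟨a, ha⟩ := jacobson_density T' s
  exact ⟨a, fun z hz => (ha z hz).symm⟩

end Schur

/-! ### The Weyl algebra -/

section Weyl

open Cardinal

variable {n : ℕ}

lemma Weyl.eq_adjoin_mon (n : ℕ) : Weyl n = Algebra.adjoin ℂ
    (Set.range (fun r : Fin n → ℤ => LinearMap.mulLeft ℂ (mon r : Laurent n)) ∪
      Set.range (fun i : Fin n => (euler i : Laurent n →ₗ[ℂ] Laurent n))) := by
  refine le_antisymm (Algebra.adjoin_le ?_) (Algebra.adjoin_mono ?_)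
  · rintro _ (⟨f, rfl⟩ | ⟨i, rfl⟩)
    · have hf := (monBasis n).mem_span f
      induction hf using Submodule.span_induction with
      | mem f hf =>
        obtain ⟨r, rfl⟩ := hf
        exact Algebra.subset_adjoin (Or.inl ⟨r, rfl⟩)
      | zero =>
        have : LinearMap.mulLeft ℂ (0 : Laurent n) = 0 := LinearMap.mulLeft_zero_eq_zero ..
        simp only [this]
        exact zero_mem _
      | add f g _ _ hf hg =>
        have : LinearMap.mulLeft ℂ (f + g) = LinearMap.mulLeft ℂ f + LinearMap.mulLeft ℂ g :=
          map_add (LinearMap.mul ℂ (Laurent n)) f g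
        simp only [this]
        exact add_mem hf hg
      | smul c f _ hf =>
        have : LinearMap.mulLeft ℂ (c • f) = c • LinearMap.mulLeft ℂ f :=
          map_smul (LinearMap.mul ℂ (Laurent n)) c f
        simp only [this]
        exact Subalgebra.smul_mem _ hf c
    · exact Algebra.subset_adjoin (Or.inr ⟨i, rfl⟩)
  · rintro _ (⟨r, rfl⟩ | ⟨i, rfl⟩)
    · exact Or.inl ⟨_, rfl⟩
    · exact Or.inr ⟨i, rfl⟩

lemma Weyl.rank_le_aleph0 (n : ℕ) : Module.rank ℂ (Weyl n) ≤ ℵ₀ := by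
  rw [Weyl.eq_adjoin_mon]
  refine (Algebra.rank_adjoin_le _).trans (max_le ?_ le_rfl)
  rw [Cardinal.le_aleph0_iff_set_countable]
  exact (Set.countable_range _).union (Set.countable_range _)

/-- The constant vector field `∑ᵢ uᵢ ∂ᵢ`, seen in the Weyl algebra. -/
noncomputable def Weyl.const : (Fin n → ℂ) →ₗ[ℂ] Weyl n :=
  ∑ i, (LinearMap.proj i).smulRight
    (⟨(euler i : Laurent n →ₗ[ℂ] Laurent n), Algebra.subset_adjoin (Or.inr ⟨i, rfl⟩)⟩ : Weyl n)

lemma Weyl.const_single (i : Fin n) : (Weyl.const (Pi.single i 1) : Weyl n) =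
    ⟨(euler i : Laurent n →ₗ[ℂ] Laurent n), Algebra.subset_adjoin (Or.inr ⟨i, rfl⟩)⟩ := by
  simp only [Weyl.const, LinearMap.sum_apply, LinearMap.smulRight_apply, LinearMap.proj_apply]
  rw [Finset.sum_eq_single i] <;> simp +contextual

lemma Weyl.const_apply_mon (u : Fin n → ℂ) (s : Fin n → ℤ) :
    (Weyl.const u).1 (mon s) = pair u s • mon s := by
  have h : (Weyl.const u).1 = ∑ i, u i • (euler i : Laurent n →ₗ[ℂ] Laurent n) := by
    simp [Weyl.const]
  rw [h]
  simp only [LinearMap.sum_apply, LinearMap.smul_apply, Derivation.coeFn_coe, euler_mon, smul_smul,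
    ← Finset.sum_smul, pair]

lemma Weyl.ofLaurent_apply_mon (r s : Fin n → ℤ) :
    (Weyl.ofLaurent (mon r)).1 (mon s) = mon (r + s) := mon_mul r s

lemma Weyl.ext_mon {a b : Weyl n} (h : ∀ s, a.1 (mon s) = b.1 (mon s)) : a = b :=
  Subtype.ext (laurent_ext h)

lemma Weyl.ofDivZero_D {u : Fin n → ℂ} {r : Fin n → ℤ} (h : pair u r = 0) :
    Weyl.ofDivZero ⟨D u r, D_mem h⟩ = Weyl.ofLaurent (mon r) * Weyl.const u := by
  refine Weyl.ext_mon fun s => ?_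
  change D u r (mon s) = (Weyl.ofLaurent (mon r)).1 ((Weyl.const u).1 (mon s))
  rw [D_mon, Weyl.const_apply_mon, map_smul, Weyl.ofLaurent_apply_mon]

lemma Weyl.const_mul_ofLaurent (u : Fin n → ℂ) (m : Fin n → ℤ) :
    Weyl.const u * Weyl.ofLaurent (mon m) =
      Weyl.ofLaurent (mon m) * (Weyl.const u + pair u m • (1 : Weyl n)) := by
  refine Weyl.ext_mon fun s => ?_
  change (Weyl.const u).1 ((Weyl.ofLaurent (mon m)).1 (mon s)) =
    (Weyl.ofLaurent (mon m)).1 ((Weyl.const u).1 (mon s) + pair u m • mon s)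
  rw [Weyl.const_apply_mon, ← add_smul, map_smul, Weyl.ofLaurent_apply_mon,
    Weyl.const_apply_mon, pair_add, add_comm]

lemma Weyl.ofLaurent_one : Weyl.ofLaurent (mon (0 : Fin n → ℤ)) = (1 : Weyl n) :=
  Weyl.ext_mon fun s => by
    rw [Weyl.ofLaurent_apply_mon, zero_add]; rfl

/-- The Weyl algebra is generated by the monomials and the `∂ᵢ`. -/
lemma Weyl.mem_subalgebra {S : Subalgebra ℂ (Weyl n)} (h₁ : ∀ r, Weyl.ofLaurent (mon r) ∈ S)
    (h₂ : ∀ i, Weyl.const (Pi.single i 1) ∈ S) (a : Weyl n) : a ∈ S := by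
  have hle : Weyl n ≤ S.map (Weyl n).val := by
    conv_lhs => rw [Weyl.eq_adjoin_mon]
    refine Algebra.adjoin_le ?_
    rintro _ (⟨r, rfl⟩ | ⟨i, rfl⟩)
    · exact ⟨_, h₁ r, rfl⟩
    · exact ⟨_, h₂ i, by rw [Weyl.const_single]; rfl⟩
  obtain ⟨b, hb, hba⟩ := hle a.2
  have : b = a := Subtype.ext hba
  exact this ▸ hb

end Weyl

/-! ### Operators on `P ⊗ V` that preserve a subspace -/

section Operators

variable (n : ℕ) (P V : Type*) [AddCommGroup P] [Module ℂ P] [Module (Weyl n) P]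
  [IsScalarTower ℂ (Weyl n) P] [AddCommGroup V] [Module ℂ V]

/-- The operator `a ⊗ 1` on `P ⊗ V`, for `a` in the Weyl algebra. -/
noncomputable def opLeft : Weyl n →ₐ[ℂ] Module.End ℂ (P ⊗[ℂ] V) :=
  AlgHom.ofLinearMap ((opTensor n P V).flip 1)
    (TensorProduct.ext' fun z y => by
      rw [LinearMap.flip_apply, opTensor_tmul, one_smul]; rfl)
    (fun a b => by
      rw [LinearMap.flip_apply, LinearMap.flip_apply, LinearMap.flip_apply, opTensor_mul, mul_one])

/-- The operator `1 ⊗ g` on `P ⊗ V`, for an operator `g` on `V`. -/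
noncomputable def opRight : Module.End ℂ V →ₐ[ℂ] Module.End ℂ (P ⊗[ℂ] V) :=
  AlgHom.ofLinearMap (opTensor n P V 1)
    (TensorProduct.ext' fun z y => by rw [opTensor_tmul, one_smul]; rfl)
    (fun a b => by rw [opTensor_mul, mul_one])

variable {n P V}

lemma opLeft_tmul (a : Weyl n) (z : P) (y : V) : opLeft n P V a (z ⊗ₜ y) = (a • z) ⊗ₜ y := rfl

lemma opRight_tmul (g : Module.End ℂ V) (z : P) (y : V) :
    opRight n P V g (z ⊗ₜ y) = z ⊗ₜ g y := by
  change opTensor n P V 1 g (z ⊗ₜ y) = _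
  rw [opTensor_tmul, one_smul]

lemma opTensor_eq_mul (a : Weyl n) (g : Module.End ℂ V) :
    opTensor n P V a g = opLeft n P V a * opRight n P V g := by
  change _ = opTensor n P V a 1 * opTensor n P V 1 g
  rw [opTensor_mul, mul_one, one_mul]

lemma opRight_mul_opLeft (a : Weyl n) (g : Module.End ℂ V) :
    opRight n P V g * opLeft n P V a = opLeft n P V a * opRight n P V g := by
  change opTensor n P V 1 g * opTensor n P V a 1 = opTensor n P V a 1 * opTensor n P V 1 g
  rw [opTensor_mul, opTensor_mul, mul_one, one_mul, mul_one, one_mul]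

variable (n P V) in
/-- Multiplication by the monomial `x^r` on `P ⊗ V`. -/
noncomputable def opMon (r : Fin n → ℤ) : Module.End ℂ (P ⊗[ℂ] V) :=
  opLeft n P V (Weyl.ofLaurent (mon r))

lemma opMon_mul_opMon (r s : Fin n → ℤ) : opMon n P V r * opMon n P V s = opMon n P V (r + s) := by
  rw [opMon, opMon, opMon, ← map_mul, ← Weyl.ofLaurent_mul, mon_mul]

lemma opMon_zero : opMon n P V 0 = 1 := by rw [opMon, Weyl.ofLaurent_one, map_one]

lemma opRight_mul_opMon (r : Fin n → ℤ) (g : Module.End ℂ V) :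
    opRight n P V g * opMon n P V r = opMon n P V r * opRight n P V g := opRight_mul_opLeft _ _

lemma opLeft_const_mul_opMon (u : Fin n → ℂ) (m : Fin n → ℤ) :
    opLeft n P V (Weyl.const u) * opMon n P V m =
      opMon n P V m * (opLeft n P V (Weyl.const u) + pair u m • 1) := by
  rw [opMon, ← map_mul, Weyl.const_mul_ofLaurent, map_mul, map_add, map_smul, map_one]

/-- The subalgebra of the operators that map a subspace into itself. -/
def stabilizer {M : Type*} [AddCommGroup M] [Module ℂ M] (N : Submodule ℂ M) :
    Subalgebra ℂ (Module.End ℂ M) where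
  carrier := {T | ∀ w ∈ N, T w ∈ N}
  mul_mem' hS hT w hw := hS _ (hT w hw)
  add_mem' hS hT w hw := N.add_mem (hS w hw) (hT w hw)
  algebraMap_mem' c _ hw := N.smul_mem c hw

variable (n) in
/-- The largest subspace of `N` that is stable under the multiplications by monomials. -/
noncomputable def monCore (N : Submodule ℂ (P ⊗[ℂ] V)) : Submodule ℂ (P ⊗[ℂ] V) :=
  ⨅ m, N.comap (opMon n P V m)

lemma mem_monCore {N : Submodule ℂ (P ⊗[ℂ] V)} {w : P ⊗[ℂ] V} :
    w ∈ monCore n N ↔ ∀ m, opMon n P V m w ∈ N := by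
  simp [monCore]

lemma monCore_le (N : Submodule ℂ (P ⊗[ℂ] V)) : monCore n N ≤ N := fun w hw => by
  simpa [opMon_zero] using mem_monCore.1 hw 0

lemma opMon_mem_stabilizer_monCore (N : Submodule ℂ (P ⊗[ℂ] V)) (r : Fin n → ℤ) :
    opMon n P V r ∈ stabilizer (monCore n N) := fun w hw => mem_monCore.2 fun m => by
  rw [← Module.End.mul_apply, opMon_mul_opMon]
  exact mem_monCore.1 hw _

variable [LieRingModule (sl n) V] [LieModule ℂ (sl n) V]

/-- The action of `D(u, r)` factors as `x^r (∂_u ⊗ 1 + 1 ⊗ r uᵀ)`. -/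
lemma act_D_eq_mul {u : Fin n → ℂ} {r : Fin n → ℤ} (h : pair u r = 0) :
    act n P V ⟨D u r, D_mem h⟩ = opMon n P V r *
      (opLeft n P V (Weyl.const u) + opRight n P V (glAct n V (outer r u))) := by
  have h₁ : LieModule.toEnd ℂ (sl n) V ⟨outer r u, outer_mem h⟩ = glAct n V (outer r u) := by
    rw [glAct, LinearMap.comp_apply, toSl_of_trace _ (outer_mem h)]; rfl
  rw [act_D' n P V h, h₁, Weyl.ofDivZero_D h, ← Module.End.one_eq_id, opTensor_eq_mul,
    opTensor_eq_mul, map_one, mul_one, map_mul, mul_add]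
  rfl

lemma act_D_mul_opMon {u : Fin n → ℂ} {r : Fin n → ℤ} (h : pair u r = 0) (m : Fin n → ℤ) :
    act n P V ⟨D u r, D_mem h⟩ * opMon n P V m =
      opMon n P V m * act n P V ⟨D u r, D_mem h⟩ + pair u m • opMon n P V (m + r) := by
  rw [act_D_eq_mul h, mul_assoc, add_mul, opLeft_const_mul_opMon, opRight_mul_opMon, ← mul_add,
    ← mul_assoc, ← mul_assoc, opMon_mul_opMon, opMon_mul_opMon, add_comm r m]
  simp only [mul_add, mul_smul_comm, mul_one]
  abel

lemma outer_single_single (i j : Fin n) (t : ℤ) :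
    outer (Pi.single i t) (Pi.single j 1) = (t : ℂ) • Matrix.single i j 1 := by
  ext a b
  simp only [outer, Matrix.vecMulVec_apply, Matrix.smul_apply, Matrix.single_apply,
    Pi.single_apply, smul_eq_mul]
  simp only [eq_comm (a := a) (b := i), eq_comm (a := b) (b := j)]
  by_cases ha : i = a <;> by_cases hb : j = b <;> simp [ha, hb]

lemma pair_single_single {i j : Fin n} (hij : i ≠ j) (t : ℤ) :
    pair (Pi.single j 1) (Pi.single i t) = 0 := by
  refine Finset.sum_eq_zero fun a _ => ?_
  by_cases ha : a = j
  · subst ha; simp [hij.symm]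
  · simp [ha]

lemma pair_single (i : Fin n) (m : Fin n → ℤ) : pair (Pi.single i 1) m = m i := by
  rw [pair, Finset.sum_eq_single i] <;> simp +contextual

/-- An `𝕊_n`-stable subspace of `P ⊗ V` is stable under all `x^m ⊗ E_ij²` with `i ≠ j`. The
products of the actions of `D(e_j, t e_i)` and `D((m_i - t) e_j - m_j e_i, m - t e_i)` are cubic
polynomials in `t` with leading coefficient `x^m ⊗ E_ij²`, which a third difference isolates. -/
theorem opMon_mul_opRight_sq_mem_stabilizer {N : Submodule ℂ (P ⊗[ℂ] V)}
    (hN : ∀ d, act n P V d ∈ stabilizer N) {i j : Fin n} (hij : i ≠ j) (m : Fin n → ℤ) :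
    opMon n P V m * opRight n P V
      (glAct n V (Matrix.single i j 1) * glAct n V (Matrix.single i j 1)) ∈ stabilizer N := by
  set e := opRight n P V (glAct n V (Matrix.single i j 1)) with he
  set u₀ : Fin n → ℂ := (m i : ℂ) • Pi.single j 1 - (m j : ℂ) • Pi.single i 1 with hu₀
  obtain ⟨a, b, c, habc⟩ : ∃ a b c : Module.End ℂ (P ⊗[ℂ] V), ∀ t : ℤ,
      opMon n P V m * ((a + (t : ℂ) • e) * (b + (t : ℂ) • c + (t : ℂ) ^ 2 • e)) ∈
        stabilizer N := by
    refine ⟨opLeft n P V (Weyl.const (Pi.single j 1)) + (m j : ℂ) • 1,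
      opLeft n P V (Weyl.const u₀) + opRight n P V (glAct n V (outer m u₀)),
      -opLeft n P V (Weyl.const (Pi.single j 1)) - opRight n P V
        (glAct n V (outer m (Pi.single j 1) + outer (Pi.single i 1) u₀)), fun t => ?_⟩
    have h₁ := pair_single_single hij t
    have h₂ : pair (u₀ - (t : ℂ) • Pi.single j 1) (m - Pi.single i t) = 0 := by
      have : ∀ (x y : Fin n → ℂ) (s : Fin n → ℤ), pair (x - y) s = pair x s - pair y s := by
        intro x y s; simp [pair, sub_mul, Finset.sum_sub_distrib]
      have h' : ∀ (c : ℂ) (y : Fin n → ℂ) (s : Fin n → ℤ), pair (c • y) s = c * pair y s := by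
        intro c y s; simp [pair, mul_assoc, Finset.mul_sum]
      rw [hu₀, this, this, h', h', h', pair_single, pair_single]
      simp [hij.symm]
      ring
    have h₃ : outer (m - Pi.single i t) (u₀ - (t : ℂ) • Pi.single j 1) = outer m u₀ -
        (t : ℂ) • (outer m (Pi.single j 1) + outer (Pi.single i 1) u₀) +
        (t : ℂ) ^ 2 • Matrix.single i j 1 := by
      have := outer_single_single i j 1
      rw [Int.cast_one, one_smul] at this
      rw [← this]
      ext x y
      by_cases hx : x = i
      · subst hx
        simp [outer, Matrix.vecMulVec_apply]
        ring
      · simp [outer, Matrix.vecMulVec_apply, hx]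
        ring
    have h₄ := (stabilizer N).mul_mem (hN ⟨_, D_mem h₁⟩) (hN ⟨_, D_mem h₂⟩)
    rw [act_D_eq_mul h₁, act_D_eq_mul h₂, outer_single_single, h₃] at h₄
    have h₅ : (opLeft n P V (Weyl.const (Pi.single j 1)) +
        opRight n P V (glAct n V ((t : ℂ) • Matrix.single i j 1))) * opMon n P V (m - Pi.single i t)
        = opMon n P V (m - Pi.single i t) *
        (opLeft n P V (Weyl.const (Pi.single j 1)) + (m j : ℂ) • 1 + (t : ℂ) • e) := by
      rw [add_mul, opLeft_const_mul_opMon, opRight_mul_opMon, ← mul_add, pair_single, map_smul,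
        map_smul]
      simp [hij.symm, he]
    rw [← mul_assoc, mul_assoc (opMon n P V (Pi.single i t)), h₅,
      ← mul_assoc (opMon n P V (Pi.single i t)), opMon_mul_opMon, add_sub_cancel, mul_assoc] at h₄
    convert h₄ using 1
    congr 2
    simp only [map_sub, map_smul, map_add, smul_add, smul_sub, smul_neg, ← he]
    abel
  -- The third difference at `t = 0, 1, 2, 3` of a cubic polynomial is `6` times its leading
  -- coefficient.
  have h6 : opMon n P V m * (e * e) = (6⁻¹ : ℂ) •
      (opMon n P V m * ((a + ((3 : ℤ) : ℂ) • e) *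
          (b + ((3 : ℤ) : ℂ) • c + ((3 : ℤ) : ℂ) ^ 2 • e)) -
        (3 : ℂ) • (opMon n P V m * ((a + ((2 : ℤ) : ℂ) • e) *
          (b + ((2 : ℤ) : ℂ) • c + ((2 : ℤ) : ℂ) ^ 2 • e))) +
        (3 : ℂ) • (opMon n P V m * ((a + ((1 : ℤ) : ℂ) • e) *
          (b + ((1 : ℤ) : ℂ) • c + ((1 : ℤ) : ℂ) ^ 2 • e))) -
        opMon n P V m * ((a + ((0 : ℤ) : ℂ) • e) *
          (b + ((0 : ℤ) : ℂ) • c + ((0 : ℤ) : ℂ) ^ 2 • e))) := by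
    simp only [mul_add, add_mul, mul_smul_comm, smul_mul_assoc]
    push_cast
    module
  rw [map_mul, ← he, h6]
  exact Subalgebra.smul_mem _ (sub_mem (add_mem (sub_mem (habc 3)
    (Subalgebra.smul_mem _ (habc 2) _)) (Subalgebra.smul_mem _ (habc 1) _)) (habc 0)) _

variable (n) in
/-- The operators `g` on `V` for which all `x^m ⊗ g` preserve the subspace `N` of `P ⊗ V`. -/
def monStabilizer (N : Submodule ℂ (P ⊗[ℂ] V)) : Set (Module.End ℂ V) :=
  {g | ∀ m, opMon n P V m * opRight n P V g ∈ stabilizer N}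

/-- Bracketing `x^{m-r} ⊗ g` with the action of `D(e_j, r)`, `r = e_i`, gives `x^m ⊗ [E_ij, g]` up to
a multiple of `x^m ⊗ g`. -/
lemma lie_mem_monStabilizer {N : Submodule ℂ (P ⊗[ℂ] V)}
    (hN : ∀ d, act n P V d ∈ stabilizer N) {i j : Fin n} (hij : i ≠ j) {g : Module.End ℂ V}
    (hg : g ∈ monStabilizer n N) :
    ⁅glAct n V (Matrix.single i j 1), g⁆ ∈ monStabilizer n N := by
  intro m
  have h := pair_single_single hij 1
  set d : DivZero n := ⟨_, D_mem h⟩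
  set r : Fin n → ℤ := Pi.single i 1
  have hd : act n P V d = opMon n P V r * (opLeft n P V (Weyl.const (Pi.single j 1)) +
      opRight n P V (glAct n V (Matrix.single i j 1))) := by
    rw [act_D_eq_mul h, outer_single_single, Int.cast_one, one_smul]
  have key : opMon n P V m * opRight n P V ⁅glAct n V (Matrix.single i j 1), g⁆ =
      act n P V d * (opMon n P V (m - r) * opRight n P V g) -
        opMon n P V (m - r) * opRight n P V g * act n P V d -
        pair (Pi.single j 1) (m - r) • (opMon n P V m * opRight n P V g) := by
    rw [← mul_assoc, act_D_mul_opMon h, sub_add_cancel, hd, Ring.lie_def, map_sub, map_mul, map_mul,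
      add_mul, smul_mul_assoc, mul_assoc (opMon n P V (m - r)) (opRight n P V g),
      ← mul_assoc (opRight n P V g), opRight_mul_opMon, mul_assoc (opMon n P V r),
      ← mul_assoc (opMon n P V (m - r)), ← mul_assoc (opMon n P V (m - r)), opMon_mul_opMon,
      sub_add_cancel, mul_add (opRight n P V g), opRight_mul_opLeft]
    simp only [mul_add, add_mul, mul_sub, mul_assoc]
    abel
  rw [key]
  exact sub_mem (sub_mem (mul_mem (hN d) (hg _)) (mul_mem (hg _) (hN d)))
    (Subalgebra.smul_mem _ (hg m) _)

lemma act_D_mem_stabilizer_monCore {N : Submodule ℂ (P ⊗[ℂ] V)}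
    (hN : ∀ d, act n P V d ∈ stabilizer N) {u : Fin n → ℂ} {r : Fin n → ℤ} (h : pair u r = 0) :
    act n P V ⟨D u r, D_mem h⟩ ∈ stabilizer (monCore n N) := fun w hw => mem_monCore.2 fun m => by
  rw [← Module.End.mul_apply, ← add_sub_cancel_right (opMon n P V m * _)
    (pair u m • opMon n P V (m + r)), ← act_D_mul_opMon h]
  exact N.sub_mem (hN _ _ (mem_monCore.1 hw m)) (N.smul_mem _ (mem_monCore.1 hw (m + r)))

lemma opLeft_const_mem_stabilizer_monCore {N : Submodule ℂ (P ⊗[ℂ] V)}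
    (hN : ∀ d, act n P V d ∈ stabilizer N) (u : Fin n → ℂ) :
    opLeft n P V (Weyl.const u) ∈ stabilizer (monCore n N) := by
  have h : pair u (0 : Fin n → ℤ) = 0 := by simp [pair]
  have h' : outer (0 : Fin n → ℤ) u = 0 := by ext; simp [outer, Matrix.vecMulVec_apply]
  have := act_D_mem_stabilizer_monCore hN h
  rwa [act_D_eq_mul h, h', opMon_zero, one_mul, map_zero, map_zero, add_zero] at this

lemma opLeft_mem_stabilizer_monCore {N : Submodule ℂ (P ⊗[ℂ] V)}
    (hN : ∀ d, act n P V d ∈ stabilizer N) (a : Weyl n) :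
    opLeft n P V a ∈ stabilizer (monCore n N) :=
  Weyl.mem_subalgebra (S := (stabilizer (monCore n N)).comap (opLeft n P V))
    (fun r => opMon_mem_stabilizer_monCore N r)
    (fun i => opLeft_const_mem_stabilizer_monCore hN (Pi.single i 1)) a

lemma opRight_single_mem_stabilizer_monCore {N : Submodule ℂ (P ⊗[ℂ] V)}
    (hN : ∀ d, act n P V d ∈ stabilizer N) {i j : Fin n} (hij : i ≠ j) :
    opRight n P V (glAct n V (Matrix.single i j 1)) ∈ stabilizer (monCore n N) := by
  have h := pair_single_single hij 1
  have h₁ := mul_mem (opMon_mem_stabilizer_monCore N (-Pi.single i 1))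
    (act_D_mem_stabilizer_monCore hN h)
  rw [act_D_eq_mul h, ← mul_assoc, opMon_mul_opMon, neg_add_cancel, opMon_zero, one_mul,
    outer_single_single, Int.cast_one, one_smul] at h₁
  have h₂ := sub_mem h₁ (opLeft_const_mem_stabilizer_monCore hN (Pi.single j 1))
  rwa [add_sub_cancel_left] at h₂

end Operators

/-! ### Irreducibility -/

section Irreducible

variable {n : ℕ} {P V : Type*} [AddCommGroup P] [Module ℂ P] [Module (Weyl n) P]
  [IsScalarTower ℂ (Weyl n) P] [AddCommGroup V] [Module ℂ V]

/-- The contraction `z ⊗ y ↦ f(z) y` of the first factor. -/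
noncomputable def contract (f : Module.Dual ℂ P) : P ⊗[ℂ] V →ₗ[ℂ] V :=
  TensorProduct.lift (f.smulRight LinearMap.id)

lemma contract_tmul (f : Module.Dual ℂ P) (z : P) (y : V) : contract f (z ⊗ₜ y) = f z • y := rfl

lemma contract_opRight (f : Module.Dual ℂ P) (g : Module.End ℂ V) (w : P ⊗[ℂ] V) :
    contract f (opRight n P V g w) = g (contract f w) := by
  induction w with
  | zero => simp
  | tmul z y => rw [opRight_tmul, contract_tmul, contract_tmul, map_smul]
  | add w w' h h' => rw [map_add, map_add, map_add, map_add, h, h']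

lemma exists_contract_ne_zero {w : P ⊗[ℂ] V} (hw : w ≠ 0) :
    ∃ f : Module.Dual ℂ P, contract f w ≠ 0 := by
  classical
  by_contra h
  push Not at h
  let b := Module.Basis.ofVectorSpace ℂ P
  apply hw
  apply (TensorProduct.equivFinsuppOfBasisLeft (N := V) b).injective
  rw [map_zero]
  ext i
  rw [Finsupp.zero_apply, ← h (b.coord i)]
  clear h hw
  induction w with
  | zero => simp
  | tmul z y => simp [contract_tmul]
  | add w w' h h' => simp [h, h']

variable [LieRingModule (sl n) V] [LieModule ℂ (sl n) V] [LieModule.IsIrreducible ℂ (sl n) V]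

/-- If some root vector does not square to zero on `V`, a nonzero `𝕊_n`-stable subspace `N` contains
a nonzero subspace stable under the monomials: some `g` in `monStabilizer n N` does not vanish on
`N`, and `1 ⊗ g` maps `N` into `monCore n N`. -/
lemma monCore_ne_bot {N : Submodule ℂ (P ⊗[ℂ] V)} (hN : ∀ d, act n P V d ∈ stabilizer N)
    (hne : N ≠ ⊥) {i j : Fin n} (hij : i ≠ j)
    (hsq : glAct n V (Matrix.single i j 1) * glAct n V (Matrix.single i j 1) ≠ 0) :
    monCore n N ≠ ⊥ := by
  intro hbot
  have hkill : ∀ g ∈ monStabilizer n N, ∀ w ∈ N, opRight n P V g w = 0 := by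
    intro g hg w hw
    rw [← Submodule.mem_bot ℂ, ← hbot, mem_monCore]
    exact fun m => hg m w hw
  -- The common kernel of the operators in `monStabilizer n N` is a submodule of `V`.
  let K : Submodule ℂ V := ⨅ g : monStabilizer n N, LinearMap.ker g.1
  have hK : ∀ v, v ∈ K ↔ ∀ g ∈ monStabilizer n N, g v = 0 := fun v => by simp [K]
  have hKst : ∀ A, ∀ v ∈ K, glAct n V A v ∈ K := by
    refine fun A => glAct_mem_of_single_mem (fun a b hab v hv => ?_) A
    rw [hK] at hv ⊢
    intro g hg
    have h := hv _ (lie_mem_monStabilizer hN hab hg)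
    rw [Ring.lie_def, LinearMap.sub_apply, Module.End.mul_apply, Module.End.mul_apply, hv g hg,
      map_zero, zero_sub, neg_eq_zero] at h
    exact h
  rcases eq_bot_or_eq_top_of_stable K hKst with h | h
  · obtain ⟨w, hw, hw0⟩ := (Submodule.ne_bot_iff N).1 hne
    obtain ⟨f, hf⟩ := exists_contract_ne_zero hw0
    refine hf ((Submodule.mem_bot ℂ).1 (h ▸ (hK _).2 fun g hg => ?_))
    rw [← contract_opRight (n := n), hkill g hg w hw, map_zero]
  · refine hsq (LinearMap.ext fun v => ?_)
    exact (hK v).1 (h ▸ Submodule.mem_top) _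
      fun m => opMon_mul_opRight_sq_mem_stabilizer hN hij m

/-- The exterior tensor product of a simple module over the Weyl algebra and an irreducible
`sl_n`-module is irreducible. -/
theorem eq_top_of_opLeft_opRight_stable [IsSimpleModule (Weyl n) P] {N : Submodule ℂ (P ⊗[ℂ] V)}
    (hl : ∀ a, opLeft n P V a ∈ stabilizer N)
    (hr : ∀ i j, i ≠ j → opRight n P V (glAct n V (Matrix.single i j 1)) ∈ stabilizer N)
    (hne : N ≠ ⊥) : N = ⊤ := by
  classical
  obtain ⟨w, hw, hw0⟩ := (Submodule.ne_bot_iff N).1 hne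
  obtain ⟨f, hf⟩ := exists_contract_ne_zero hw0
  -- By density, `z ⊗ contract f w` is obtained from `w` by an element of the Weyl algebra.
  have hz : ∀ z : P, z ⊗ₜ contract f w ∈ N := by
    intro z
    obtain ⟨s, hs⟩ := TensorProduct.exists_finset w
    obtain ⟨a, ha⟩ := exists_smul_eq_of_rank_le_aleph0 (Weyl.rank_le_aleph0 n)
      (f.smulRight z : Module.End ℂ P) (s.image Prod.fst)
    have : opLeft n P V a w = z ⊗ₜ contract f w := by
      rw [hs, map_sum, map_sum, TensorProduct.tmul_sum]
      refine Finset.sum_congr rfl fun p hp => ?_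
      rw [opLeft_tmul, ha p.1 (Finset.mem_image_of_mem _ hp), contract_tmul,
        LinearMap.smulRight_apply, TensorProduct.smul_tmul]
    exact this ▸ hl a w hw
  let K : Submodule ℂ V := ⨅ z : P, N.comap (TensorProduct.mk ℂ P V z)
  have hK : ∀ v, v ∈ K ↔ ∀ z : P, z ⊗ₜ v ∈ N := fun v => by simp [K]
  have hKst : ∀ A, ∀ v ∈ K, glAct n V A v ∈ K := by
    refine fun A => glAct_mem_of_single_mem (fun a b hab v hv => (hK _).2 fun z => ?_) A
    rw [← opRight_tmul (n := n)]
    exact hr a b hab _ ((hK v).1 hv z)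
  rcases eq_bot_or_eq_top_of_stable K hKst with h | h
  · exact absurd ((Submodule.mem_bot ℂ).1 (h ▸ (hK _).2 hz)) hf
  · rw [eq_top_iff, ← TensorProduct.span_tmul_eq_top, Submodule.span_le]
    rintro _ ⟨z, v, rfl⟩
    exact (hK v).1 (h ▸ Submodule.mem_top) z

end Irreducible

end TorusFields

theorem mainTheorem1 (n : ℕ) (hn : 2 ≤ n)
    (P : Type*) [AddCommGroup P] [Module ℂ P] [Module (TorusFields.Weyl n) P]
    [IsScalarTower ℂ (TorusFields.Weyl n) P] [IsSimpleModule (TorusFields.Weyl n) P]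
    (V : Type*) [AddCommGroup V] [Module ℂ V] [LieRingModule (TorusFields.sl n) V]
    [LieModule ℂ (TorusFields.sl n) V] [LieModule.IsIrreducible ℂ (TorusFields.sl n) V]
    (hV : ∀ k < n, IsEmpty (V ≃ₗ⁅ℂ, TorusFields.sl n⁆ TorusFields.Fund n k)) :
    LieModule.IsIrreducible ℂ (TorusFields.DivZero n) (TorusFields.F P V) := by
  -- Otherwise `V` would be an exterior power.
  obtain ⟨i, j, hij, hsq⟩ : ∃ i j : Fin n, i ≠ j ∧
      TorusFields.glAct n V (Matrix.single i j 1) *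
        TorusFields.glAct n V (Matrix.single i j 1) ≠ 0 := by
    by_contra h
    push Not at h
    obtain ⟨k, hk, ⟨e⟩⟩ := TorusFields.exists_equiv_fund (V := V) (by omega) h
    exact (hV k hk).false e
  have hP : Nontrivial P := IsSimpleModule.nontrivial (TorusFields.Weyl n) P
  have hV' : Nontrivial V := LieModule.nontrivial_of_isIrreducible ℂ (TorusFields.sl n) V
  have hF : Nontrivial (TorusFields.F P V) :=
    inferInstanceAs (Nontrivial (TensorProduct ℂ P V))
  refine LieModule.IsIrreducible.mk fun N hN => ?_
  let N' : Submodule ℂ (TensorProduct ℂ P V) := N.toSubmodule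
  have hst : ∀ d, TorusFields.act n P V d ∈ TorusFields.stabilizer N' :=
    fun d w hw => N.lie_mem (x := d) (m := w) hw
  have hne : N' ≠ ⊥ := fun h => hN ((LieSubmodule.toSubmodule_eq_bot N).1 h)
  have htop := TorusFields.eq_top_of_opLeft_opRight_stable
    (TorusFields.opLeft_mem_stabilizer_monCore hst)
    (fun i j hij => TorusFields.opRight_single_mem_stabilizer_monCore hst hij)
    (TorusFields.monCore_ne_bot hst hne hij hsq)
  have : N' = ⊤ := top_le_iff.1 (htop ▸ TorusFields.monCore_le N')
  exact (LieSubmodule.toSubmodule_eq_top N).1 this
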